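/- Let $H$ be a real Hilbert space with inner product $\langle\cdot,\cdot\rangle$ and norm $\|\cdot\|_2$. Let $\|\cdot\|$ be another norm on $H$ with $\|x\|_2\le\kappa\|x\|$ for all $x$ and some constant $\kappa$ (automatic if $\dim H<\infty$), and let $\|g\|_*=\sup\{\langle g,x\rangle:\|x\|\le 1\}$. Let $Q\subset H$ be nonempty, closed and convex. Let $d$ be a lower semicontinuous prox-function on $Q$, $1$-strongly convex with respect to $\|\cdot\|$, whose prox-diameter is at most $R>0$, i.e. $\sup_Q d-\inf_Q d\le R^2/2$. The problem is $$f(x)=E_\xi[f(x,\xi)]\to\min_{x\in Q},$$ where $f$ is convex with $\nu$-Hölder gradient, $\nu\in[0,1]$: $$\|\nabla f(x)-\nabla f(y)\|_*\le L_\nu\|x-y\|^\nu\qquad(x,y\in Q)$$ (precisely: there is a choice of subgradients $\nabla f(x)$ of $f$ on $Q$ with this property; for $\nu=0$ the problem is nonsmooth). A $(\delta,L,D)$-oracle with convexity parameter $\mu\ge0$ answers each query $x\in Q$ with $(F(x,\xi),G(x,\xi))$, where $\xi$ is drawn independently at each call, such that for all $x,y\in Q$ $$E_\xi\|G(x,\xi)-E_\xi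 G(x,\xi)\|_*^2\le D,$$ $$\tfrac{\mu}{2}\|y-x\|^2\le f(y)-E_\xi F(x,\xi)-\langle E_\xi G(x,\xi),y-x\rangle\le\tfrac L2\|y-x\|^2+\delta .$$ For a problem with $\nu$-Hölder gradient, the oracle is a $(\delta,L(\delta),D)$-oracle with some $\delta>0$ and $$L(\delta)=L_\nu\Big[\frac{L_\nu(1-\nu)}{2\delta(1+\nu)}\Big]^{\frac{1-\nu}{1+\nu}}$$ (exact values and an unbiased stochastic gradient of variance at most $D$ form such an oracle for every $\delta>0$). A method chooses its queries in $Q$ and its output in $Q$ as functions of the oracle answers received so far. It does not know $f$, the law of $\xi$, the oracle or $\delta$, but it may depend on all the other data: $Q$, $d$, $R$, $\nu$, $L_\nu$, $D$, $\varepsilon$, $p$ (and $\mu_2$). There are absolute constants $C,c>0$ and two families of methods with parameter $p\in[0,1]$ such that the following holds for all $\nu\in[0,1]$, $L_\nu\ge0$, $D\ge0$, $\varepsilon>0$. 1. (Convex case, $\mu=0$.) Let $$\bar N_1(\varepsilon)=C\max\Big\{1,\Big(\frac{L_\nu R^{1+\nu}}{\varepsilon}\Big)^{\frac{2}{1+2p\nu+\nu}}\Big\}.$$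 The method of the first family makes at most $N_1(\varepsilon)=\max\{\bar N_1(\varepsilon),\,CDR^2/\varepsilon^2\}$ oracle calls, and its output $\hat x$ satisfies $E f(\hat x)-\min_Q f\le\varepsilon$ whenever $\delta\le c\,\varepsilon/\bar N_1(\varepsilon)^p$. 2. (Strongly convex case.) Let $\|\cdot\|=\|\cdot\|_2$, let the prox-structure be Euclidean, with centre $x_0\in Q$ and $\|x-x_0\|_2\le R_2$ for all $x\in Q$ ($R_2>0$), and let $L_{\nu,2}$, $D_2$ denote the constants $L_\nu$, $D$ for this norm. Let $f$ be $\mu_2$-strongly convex on $Q$ in $\|\cdot\|_2$, $\mu_2>0$, and let the oracle have convexity parameter $\mu=\mu_2$. Let $$\bar N_2(\varepsilon)=C\max\Big\{1,\Big(\frac{L_{\nu,2}^{2/(1+\nu)}}{\mu_2\,\varepsilon^{(1-\nu)/(1+\nu)}}\Big)^{\frac{1+\nu}{1+2p\nu+\nu}}\Big\}\cdot\max\Big\{1,\Big\lceil\ln\frac{\mu_2R_2^2}{\varepsilon}\Big\rceil\Big\}.$$ The method of the second family makes at most $N_2(\varepsilon)=\max\{\bar N_2(\varepsilon),\,CD_2/(\mu_2\varepsilon)\}$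 oracle calls, and its output $\hat x$ satisfies $E f(\hat x)-\min_Q f\le\varepsilon$ whenever $\delta\le c\,\varepsilon/\bar N_2(\varepsilon)^p$. -/

import Mathlib

open MeasureTheory Topology
open scoped RealInnerProductSpace

/-- The dual norm `‖g‖_* = sup {⟨g, x⟩ : N x ≤ 1}` of a second norm `N` on a Hilbert space. -/
noncomputable def dualNorm {H : Type*} [NormedAddCommGroup H] [InnerProductSpace ℝ H]
    (N : Seminorm ℝ H) (g : H) : ℝ :=
  sSup ((fun x : H => ⟪g, x⟫) '' {x : H | N x ≤ 1})

/-- A prox-structure on `Q` for the norm `N`: a lower semicontinuous prox-function `d` which is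
`1`-strongly convex on `Q` with respect to `N`, and for which the prox-diameter
`√(2 (sup_Q d - inf_Q d))` of `Q` is at most `R`. -/
structure IsProxStructure {H : Type*} [NormedAddCommGroup H] [InnerProductSpace ℝ H]
    (N : Seminorm ℝ H) (Q : Set H) (d : H → ℝ) (R : ℝ) : Prop where
  lsc : LowerSemicontinuousOn d Q
  strongConvex : ∀ x ∈ Q, ∀ y ∈ Q, ∀ a b : ℝ, 0 ≤ a → 0 ≤ b → a + b = 1 →
    d (a • x + b • y) ≤ a * d x + b * d y - a * b * (N (x - y) ^ 2 / 2)
  diam : ∀ x ∈ Q, ∀ y ∈ Q, d x - d y ≤ R ^ 2 / 2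

/-- `f` is a convex function on `Q` whose gradient satisfies
`‖∇f(x) - ∇f(y)‖_* ≤ L ‖x - y‖ ^ ν` on `Q`. The gradient is given by a map `g` that selects a
subgradient of `f` on `Q` at every point of `Q`; so `f` is convex on `Q`. For `ν > 0` the two
conditions force `f` to be differentiable along `Q` with gradient `g`; for `ν = 0` this is the
nonsmooth case of subgradients with bounded differences. -/
def HasHolderGradient {H : Type*} [NormedAddCommGroup H] [InnerProductSpace ℝ H]
    (N : Seminorm ℝ H) (Q : Set H) (f : H → ℝ) (L ν : ℝ) : Prop :=
  ∃ g : H → H,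
    (∀ x ∈ Q, ∀ y ∈ Q, f x + ⟪g x, y - x⟫ ≤ f y) ∧
    (∀ x ∈ Q, ∀ y ∈ Q, dualNorm N (g x - g y) ≤ L * N (x - y) ^ ν)

/-- The Lipschitz constant `L_ν [L_ν (1 - ν) / (2 δ (1 + ν))] ^ ((1 - ν) / (1 + ν))` with which a
function with `ν`-Hölder gradient is treated, at accuracy `δ > 0`, as a smooth function. It equals
`L_ν` for `ν = 1`. -/
noncomputable def holderSmoothness (Lν ν δ : ℝ) : ℝ :=
  Lν * (Lν * (1 - ν) / (2 * δ * (1 + ν))) ^ ((1 - ν) / (1 + ν))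

/-- The objective `f(x) = E_ξ [f(x, ξ)]`. -/
noncomputable def objective {H Ξ : Type*} [MeasurableSpace Ξ] (P : Measure Ξ)
    (φ : H → Ξ → ℝ) (x : H) : ℝ :=
  ∫ ξ, φ x ξ ∂P

/-- A stochastic inexact `(δ, L, D)`-oracle on `Q`, with convexity parameter `μ`, for the objective
`f(x) = E_ξ [φ(x, ξ)]`. It answers a query `x` with `(F x ξ, G x ξ)`, where `ξ` has law `P`.
Measurability of `G` is asked jointly in `(x, ξ)`, for `x` in separable parts of `Q`; on a separable
space this is joint measurability on `Q × Ξ`. -/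
structure IsOracle {H Ξ : Type*} [NormedAddCommGroup H] [InnerProductSpace ℝ H]
    [MeasurableSpace H] [MeasurableSpace Ξ] (N : Seminorm ℝ H) (Q : Set H) (P : Measure Ξ)
    (φ : H → Ξ → ℝ) (F : H → Ξ → ℝ) (G : H → Ξ → H) (μ δ L D : ℝ) : Prop where
  integrable_objective : ∀ x ∈ Q, Integrable (φ x) P
  integrable_value : ∀ x ∈ Q, Integrable (F x) P
  measurable_grad : ∀ S : Set H, S ⊆ Q → TopologicalSpace.IsSeparable S →
    StronglyMeasurable (fun z : S × Ξ => G z.1 z.2)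
  integrable_grad : ∀ x ∈ Q, Integrable (G x) P
  integrable_variance : ∀ x ∈ Q,
    Integrable (fun ξ => dualNorm N (G x ξ - ∫ ξ', G x ξ' ∂P) ^ 2) P
  variance_le : ∀ x ∈ Q, ∫ ξ, dualNorm N (G x ξ - ∫ ξ', G x ξ' ∂P) ^ 2 ∂P ≤ D
  lower : ∀ x ∈ Q, ∀ y ∈ Q, μ / 2 * N (y - x) ^ 2 ≤
    objective P φ y - ∫ ξ, F x ξ ∂P - ⟪∫ ξ, G x ξ ∂P, y - x⟫
  upper : ∀ x ∈ Q, ∀ y ∈ Q,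
    objective P φ y - ∫ ξ, F x ξ ∂P - ⟪∫ ξ, G x ξ ∂P, y - x⟫ ≤ L / 2 * N (y - x) ^ 2 + δ

/-- A method on `Q` that has access to the problem only through oracle answers: the next query and
the output are functions of the list of the answers obtained so far (most recent first). -/
structure OracleMethod {H : Type*} (Q : Set H) where
  query : List (ℝ × H) → H
  output : List (ℝ × H) → H
  query_mem : ∀ h, query h ∈ Q
  output_mem : ∀ h, output h ∈ Q

/-- The answers that a method receives in its first `n` oracle calls (most recent first), when the
`k`-th call (`k = 0, 1, …`) draws the random element `ξ k`. -/
def OracleMethod.answers {H Ξ : Type*} {Q : Set H} (A : OracleMethod Q)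
    (F : H → Ξ → ℝ) (G : H → Ξ → H) (ξ : ℕ → Ξ) : ℕ → List (ℝ × H)
  | 0 => []
  | k + 1 =>
    (F (A.query (A.answers F G ξ k)) (ξ k), G (A.query (A.answers F G ξ k)) (ξ k)) ::
      A.answers F G ξ k

/-- The point returned after `n` oracle calls. -/
def OracleMethod.result {H Ξ : Type*} {Q : Set H} (A : OracleMethod Q)
    (F : H → Ξ → ℝ) (G : H → Ξ → H) (n : ℕ) (ξ : ℕ → Ξ) : H :=
  A.output (A.answers F G ξ n)

/-- With `n` oracle calls, which draw independent `ξ`'s with law `P`, the method finds an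
`ε`-solution in expectation: `E f(x_n) - min_Q f ≤ ε`. -/
def OracleMethod.Solves {H Ξ : Type*} [MeasurableSpace Ξ] {Q : Set H} (A : OracleMethod Q)
    (P : Measure Ξ) [IsProbabilityMeasure P] (φ : H → Ξ → ℝ)
    (F : H → Ξ → ℝ) (G : H → Ξ → H) (n : ℕ) (ε : ℝ) : Prop :=
  Integrable (fun ξ : ℕ → Ξ => objective P φ (A.result F G n ξ))
      (Measure.infinitePi fun _ : ℕ => P) ∧
    ∀ y ∈ Q, (∫ ξ : ℕ → Ξ, objective P φ (A.result F G n ξ)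
      ∂(Measure.infinitePi fun _ : ℕ => P)) - objective P φ y ≤ ε

/-- `max {1, (L_ν R ^ (1 + ν) / ε) ^ (2 / (1 + 2 p ν + ν))}`. -/
noncomputable def convexRate (p ν Lν R ε : ℝ) : ℝ :=
  max 1 ((Lν * R ^ (1 + ν) / ε) ^ (2 / (1 + 2 * p * ν + ν)))

/-- `max {1, (L_ν ^ (2 / (1 + ν)) / (μ ε ^ ((1 - ν) / (1 + ν)))) ^ ((1 + ν) / (1 + 2 p ν + ν))}`
times `max {1, ⌈ln (μ R ^ 2 / ε)⌉}`. -/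
noncomputable def stronglyConvexRate (p ν Lν μ R ε : ℝ) : ℝ :=
  max 1 ((Lν ^ (2 / (1 + ν)) / (μ * ε ^ ((1 - ν) / (1 + ν)))) ^
      ((1 + ν) / (1 + 2 * p * ν + ν))) *
    max 1 (⌈Real.log (μ * R ^ 2 / ε)⌉ : ℝ)

/-!
The method is a mirror-descent method of intermediate type, restarted in the strongly convex case,
and it is analysed with one estimate for both cases.

*Reduction of the oracle error.* The method does not know `δ`, and a small `δ` comes with a large
constant `L(δ)`. As the objective has a `ν`-Hölder gradient, a `(δ, L(δ))`-oracle is also a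
`(5 δ', 6 L(δ'))`-oracle for every `δ' ≥ δ` (`IsInexactModel.of_le_accuracy`). So the method can be
designed for a known `δ'` of the order of `ε / K ^ p`, where `K` is the iteration rate; for this
accuracy `L(δ') ≤ 10 μ K ^ (1 + p)` (`holderSmoothness_le_iterationRate`), with `μ = ε / R ^ 2` in
the convex case.

*One stage.* With a parameter `M ≥ 1`, gradients are weighted by `α_i`, which grow linearly up to
`1` and stay constant afterwards. The query is a convex combination of the current approximate
solution and the last prox-point with coefficient `1 / (M α_i)`. After `n ≥ M` iterations with
prox-weight `β ≥ 2 L / M` the error is at most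
`4 β V / n + M δ + D / β`, where `V` is the initial prox-distance to the solution
(`IsInexactModel.error_le` for a realization, `RestartParams.Valid.integral_centre_succ_le` in
expectation). The amplification `M` of the oracle error does not depend on `n`: a long run, which
averages out the noise, does not accumulate the error `δ`. With `M = K ^ p` and a run of length
of the order of `K + D / (μ ε)` each of the three terms is at most a fraction of `ε`.

*Expectation.* The prox-points depend only on earlier draws. As the law of independent draws is
invariant under drawing one of them anew (`measurePreserving_update`), the deviations of the
stochastic gradients are orthogonal in mean to the prox-points and have second moments at most `D`.

*Restarts.* In the strongly convex case the distance of the result of a stage from the minimizer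
is controlled by its accuracy, so every stage divides the accuracy by `4`
(`IsOracle.integral_centre_succ_sub_le`), and the logarithmic number of stages suffices. The part of
the stage lengths that is due to the noise grows geometrically. The convex case is the case of a
single stage.
-/

/-! ### Dual norms -/

section DualNorm

variable {H : Type*} [NormedAddCommGroup H] [InnerProductSpace ℝ H] {N : Seminorm ℝ H} {κ : ℝ}

theorem norm_le_abs_mul_seminorm (hN : ∀ x, ‖x‖ ≤ κ * N x) (x : H) : ‖x‖ ≤ |κ| * N x :=
  (hN x).trans (mul_le_mul_of_nonneg_right (le_abs_self κ) (apply_nonneg N x))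

theorem inner_le_of_seminorm_le_one (hN : ∀ x, ‖x‖ ≤ κ * N x) (g : H) {x : H} (hx : N x ≤ 1) :
    ⟪g, x⟫ ≤ |κ| * ‖g‖ := by
  have h1 := norm_le_abs_mul_seminorm hN x
  have h2 : ‖x‖ ≤ |κ| := h1.trans (mul_le_of_le_one_right (abs_nonneg κ) hx)
  calc ⟪g, x⟫ ≤ ‖g‖ * ‖x‖ := real_inner_le_norm g x
    _ ≤ ‖g‖ * |κ| := by gcongr
    _ = |κ| * ‖g‖ := mul_comm _ _

theorem bddAbove_dualNorm (hN : ∀ x, ‖x‖ ≤ κ * N x) (g : H) :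
    BddAbove ((fun x : H => ⟪g, x⟫) '' {x : H | N x ≤ 1}) := by
  refine ⟨|κ| * ‖g‖, ?_⟩
  rintro _ ⟨x, hx, rfl⟩
  exact inner_le_of_seminorm_le_one hN g hx

theorem dualNorm_nonneg (hN : ∀ x, ‖x‖ ≤ κ * N x) (g : H) : 0 ≤ dualNorm N g :=
  le_csSup (bddAbove_dualNorm hN g) ⟨0, by simp, by simp⟩

theorem inner_le_dualNorm_mul (hN : ∀ x, ‖x‖ ≤ κ * N x) (g x : H) :
    ⟪g, x⟫ ≤ dualNorm N g * N x := by
  rcases (apply_nonneg N x).eq_or_lt with h0 | h0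
  · have hx : x = 0 := by
      have := hN x
      rw [← h0, mul_zero] at this
      exact norm_le_zero_iff.mp this
    simp [hx]
  · have h1 : ⟪g, (N x)⁻¹ • x⟫ ≤ dualNorm N g := by
      refine le_csSup (bddAbove_dualNorm hN g) ⟨(N x)⁻¹ • x, ?_, rfl⟩
      simp [map_smul_eq_mul, abs_of_pos h0, h0.ne']
    rw [inner_smul_right, inv_mul_le_iff₀ h0] at h1
    linarith

theorem abs_inner_le_dualNorm_mul (hN : ∀ x, ‖x‖ ≤ κ * N x) (g x : H) :
    |⟪g, x⟫| ≤ dualNorm N g * N x := by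
  refine abs_le'.2 ⟨inner_le_dualNorm_mul hN g x, ?_⟩
  have := inner_le_dualNorm_mul hN g (-x)
  rwa [inner_neg_right, map_neg_eq_map] at this

theorem continuous_dualNorm (hN : ∀ x, ‖x‖ ≤ κ * N x) : Continuous (dualNorm N) := by
  refine (LipschitzWith.of_le_add_mul (Real.nnabs κ) fun g g' => ?_).continuous
  refine csSup_le ⟨_, 0, by simp, rfl⟩ ?_
  rintro _ ⟨x, hx, rfl⟩
  have h1 : ⟪g', x⟫ ≤ dualNorm N g' := le_csSup (bddAbove_dualNorm hN g') ⟨x, hx, rfl⟩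
  have h2 := inner_le_of_seminorm_le_one hN (g - g') hx
  rw [inner_sub_left] at h2
  rw [dist_eq_norm]
  simp only [Real.coe_nnabs]
  linarith

end DualNorm

/-! ### Prox-mappings -/

section Prox

variable {H : Type*} [NormedAddCommGroup H] [InnerProductSpace ℝ H] {N : Seminorm ℝ H} {κ : ℝ}
  {Q : Set H} {d : H → ℝ} {R : ℝ}

/-- Strong convexity bounds the `N`-diameter of `Q` by the prox-diameter. -/
theorem IsProxStructure.seminorm_sub_le (hd : IsProxStructure N Q d R) (hR : 0 ≤ R)
    (hQ : Convex ℝ Q) {x y : H} (hx : x ∈ Q) (hy : y ∈ Q) : N (x - y) ≤ 2 * R := by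
  have h1 := hd.strongConvex x hx y hy (1 / 2) (1 / 2) (by norm_num) (by norm_num) (by norm_num)
  have hm : (1 / 2 : ℝ) • x + (1 / 2 : ℝ) • y ∈ Q :=
    hQ hx hy (by norm_num) (by norm_num) (by norm_num)
  have h2 := hd.diam x hx _ hm
  have h3 := hd.diam y hy _ hm
  nlinarith [apply_nonneg N (x - y)]

/-- A lower semicontinuous strongly convex function, tilted by a linear functional, attains its
minimum on a closed convex set, and it grows quadratically away from the minimizer. -/
theorem IsProxStructure.exists_argmin [CompleteSpace H] (hN : ∀ x, ‖x‖ ≤ κ * N x)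
    (hd : IsProxStructure N Q d R) (hR : 0 ≤ R) (hne : Q.Nonempty) (hcl : IsClosed Q)
    (hQ : Convex ℝ Q) {β : ℝ} (hβ : 0 < β) (s : H) :
    ∃ z ∈ Q, ∀ x ∈ Q, β * d z + ⟪s, z⟫ + β / 2 * N (x - z) ^ 2 ≤ β * d x + ⟪s, x⟫ := by
  set Φ : H → ℝ := fun x => β * d x + ⟪s, x⟫ with hΦ
  have hsc : ∀ x ∈ Q, ∀ y ∈ Q, ∀ a b : ℝ, 0 ≤ a → 0 ≤ b → a + b = 1 →
      Φ (a • x + b • y) ≤ a * Φ x + b * Φ y - a * b * (β / 2 * N (x - y) ^ 2) := by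
    intro x hx y hy a b ha hb hab
    have := mul_le_mul_of_nonneg_left (hd.strongConvex x hx y hy a b ha hb hab) hβ.le
    simp only [hΦ, inner_add_right, inner_smul_right]
    nlinarith
  obtain ⟨q, hq⟩ := hne
  have hbdd : BddBelow (Φ '' Q) := by
    refine ⟨β * (d q - R ^ 2 / 2) + (⟪s, q⟫ - dualNorm N s * (2 * R)), ?_⟩
    rintro _ ⟨x, hx, rfl⟩
    have h1 := mul_le_mul_of_nonneg_left (hd.diam q hq x hx) hβ.le
    have h2 := inner_le_dualNorm_mul hN s (q - x)
    have h3 := mul_le_mul_of_nonneg_left (hd.seminorm_sub_le hR hQ hq hx) (dualNorm_nonneg hN s)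
    rw [inner_sub_right] at h2
    simp only [hΦ]
    linarith
  set m := sInf (Φ '' Q) with hm
  have hmle : ∀ x ∈ Q, m ≤ Φ x := fun x hx => csInf_le hbdd ⟨x, hx, rfl⟩
  have hex : ∀ k : ℕ, ∃ x ∈ Q, Φ x < m + 1 / ((k : ℝ) + 1) := by
    intro k
    obtain ⟨_, ⟨x, hx, rfl⟩, h⟩ := exists_lt_of_csInf_lt (Set.Nonempty.image Φ ⟨q, hq⟩)
      (show sInf (Φ '' Q) < m + 1 / ((k : ℝ) + 1) by
        rw [← hm]; linarith [Nat.one_div_pos_of_nat (α := ℝ) (n := k)])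
    exact ⟨x, hx, h⟩
  choose w hwQ hw using hex
  have hwd : ∀ k l K : ℕ, K ≤ k → K ≤ l →
      dist (w k) (w l) ≤ |κ| * √(8 / β * (1 / ((K : ℝ) + 1))) := by
    intro k l K hk hl
    have h1 := hsc _ (hwQ k) _ (hwQ l) (1 / 2) (1 / 2) (by norm_num) (by norm_num) (by norm_num)
    have h2 := hmle _ (hQ (hwQ k) (hwQ l) (by norm_num : (0 : ℝ) ≤ 1 / 2)
      (by norm_num : (0 : ℝ) ≤ 1 / 2) (by norm_num))
    have h3 := Nat.one_div_le_one_div (α := ℝ) hk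
    have h4 := Nat.one_div_le_one_div (α := ℝ) hl
    have h5 := hw k
    have h6 := hw l
    have h7 : N (w k - w l) ^ 2 ≤ 8 / β * (1 / ((K : ℝ) + 1)) := by
      rw [div_mul_eq_mul_div, le_div_iff₀ hβ]
      linarith
    rw [dist_eq_norm]
    refine (norm_le_abs_mul_seminorm hN _).trans ?_
    gcongr
    exact Real.le_sqrt_of_sq_le h7
  have hlim : Filter.Tendsto (fun K : ℕ => |κ| * √(8 / β * (1 / ((K : ℝ) + 1))))
      Filter.atTop (𝓝 0) := by
    have h := (tendsto_one_div_add_atTop_nhds_zero_nat (𝕜 := ℝ)).const_mul (8 / β)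
    have h' := ((Real.continuous_sqrt.tendsto _).comp h).const_mul |κ|
    simpa using h'
  have hc : CauchySeq w := cauchySeq_of_le_tendsto_0 _ hwd hlim
  obtain ⟨z, hz⟩ := cauchySeq_tendsto_of_complete hc
  have hzQ : z ∈ Q := hcl.mem_of_tendsto hz (Filter.Eventually.of_forall hwQ)
  have hlsc : LowerSemicontinuousOn Φ Q := by
    have h1 : LowerSemicontinuousOn (fun x => β * d x) Q := by
      intro x hx y hy
      have h := hd.lsc x hx (y / β) ((div_lt_iff₀' hβ).2 hy)
      filter_upwards [h] with t ht using (div_lt_iff₀' hβ).1 ht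
    have h2 : Continuous fun x : H => ⟪s, x⟫ := by fun_prop
    exact h1.add (h2.lowerSemicontinuous.lowerSemicontinuousOn _)
  have hzm : Φ z ≤ m := by
    by_contra! hlt
    have h1 := hlsc z hzQ ((Φ z + m) / 2) (by linarith)
    have h2 : Filter.Tendsto w Filter.atTop (𝓝[Q] z) :=
      tendsto_nhdsWithin_iff.2 ⟨hz, Filter.Eventually.of_forall hwQ⟩
    have h3 := h2.eventually h1
    have h4 : Filter.Tendsto (fun k : ℕ => m + 1 / ((k : ℝ) + 1)) Filter.atTop (𝓝 (m + 0)) :=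
      tendsto_const_nhds.add tendsto_one_div_add_atTop_nhds_zero_nat
    have h5 := h4.eventually (gt_mem_nhds (show m + 0 < (Φ z + m) / 2 by linarith))
    obtain ⟨k, hk3, hk5⟩ := (h3.and h5).exists
    linarith [hw k]
  refine ⟨z, hzQ, fun x hx => ?_⟩
  change Φ z + β / 2 * N (x - z) ^ 2 ≤ Φ x
  have hstep : ∀ a : ℝ, 0 < a → a ≤ 1 → Φ z + (1 - a) * (β / 2 * N (x - z) ^ 2) ≤ Φ x := by
    intro a ha ha1
    have h1 := hsc x hx z hzQ a (1 - a) ha.le (by linarith) (by ring)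
    have h2 := hzm.trans (hmle _ (hQ hx hzQ ha.le (by linarith : 0 ≤ 1 - a) (by ring)))
    have h3 : a * (Φ z + (1 - a) * (β / 2 * N (x - z) ^ 2)) ≤ a * Φ x := by nlinarith
    exact le_of_mul_le_mul_left h3 ha
  have hcont : Filter.Tendsto (fun a : ℝ => Φ z + (1 - a) * (β / 2 * N (x - z) ^ 2)) (𝓝[>] 0)
      (𝓝 (Φ z + (1 - 0) * (β / 2 * N (x - z) ^ 2))) :=
    Continuous.tendsto (by fun_prop) (0 : ℝ) |>.mono_left nhdsWithin_le_nhds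
  rw [sub_zero, one_mul] at hcont
  refine le_of_tendsto hcont ?_
  filter_upwards [Ioc_mem_nhdsGT (zero_lt_one' ℝ)] with a ha using hstep a ha.1 ha.2

/-- A prox-mapping for a family of Bregman-like distances `V u` on `Q` with centres `u`: the point
`Z β u s` minimizes `β V u + ⟨s, ·⟩` on `Q`, with quadratic growth at the minimizer. -/
structure IsProxMap (N : Seminorm ℝ H) (Q : Set H) (V : H → H → ℝ) (Z : ℝ → H → H → H) :
    Prop where
  mem : ∀ β, 0 < β → ∀ u s, Z β u s ∈ Q
  continuous : ∀ β, 0 < β → Continuous fun q : H × H => Z β q.1 q.2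
  nonneg : ∀ u ∈ Q, ∀ x ∈ Q, 0 ≤ V u x
  growth : ∀ β, 0 < β → ∀ u ∈ Q, ∀ s, ∀ x ∈ Q,
    β * V u (Z β u s) + ⟪s, Z β u s⟫ + β / 2 * N (x - Z β u s) ^ 2 ≤ β * V u x + ⟪s, x⟫

theorem IsProxStructure.exists_continuous_argmin [CompleteSpace H] (hN : ∀ x, ‖x‖ ≤ κ * N x)
    (hd : IsProxStructure N Q d R) (hR : 0 ≤ R) (hne : Q.Nonempty) (hcl : IsClosed Q)
    (hQ : Convex ℝ Q) :
    ∃ Z : ℝ → H → H, ∀ β, 0 < β → (∀ s, Z β s ∈ Q) ∧ Continuous (Z β) ∧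
      ∀ s, ∀ x ∈ Q, β * d (Z β s) + ⟪s, Z β s⟫ + β / 2 * N (x - Z β s) ^ 2 ≤
        β * d x + ⟪s, x⟫ := by
  have hex : ∀ β : ℝ, ∀ s : H, ∃ z, 0 < β → z ∈ Q ∧
      ∀ x ∈ Q, β * d z + ⟪s, z⟫ + β / 2 * N (x - z) ^ 2 ≤ β * d x + ⟪s, x⟫ := by
    intro β s
    by_cases hβ : 0 < β
    · obtain ⟨z, hz⟩ := hd.exists_argmin hN hR hne hcl hQ hβ s
      exact ⟨z, fun _ => hz⟩
    · exact ⟨0, fun h => absurd h hβ⟩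
  choose Z hZ using hex
  refine ⟨Z, fun β hβ => ⟨fun s => (hZ β s hβ).1, ?_, fun s => (hZ β s hβ).2⟩⟩
  refine (LipschitzWith.of_dist_le' (K := |κ| * |κ| / β) fun s t => ?_).continuous
  have h1 := (hZ β s hβ).2 _ (hZ β t hβ).1
  have h2 := (hZ β t hβ).2 _ (hZ β s hβ).1
  rw [map_sub_rev N] at h1
  set r := N (Z β s - Z β t) with hr
  have hr0 : 0 ≤ r := apply_nonneg N _
  have h3 : β * r ^ 2 ≤ ⟪t - s, Z β s - Z β t⟫ := by
    simp only [inner_sub_left, inner_sub_right]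
    linarith
  have h4 : ⟪t - s, Z β s - Z β t⟫ ≤ dist s t * (|κ| * r) := by
    rw [dist_comm, dist_eq_norm]
    refine (real_inner_le_norm _ _).trans ?_
    gcongr
    exact norm_le_abs_mul_seminorm hN _
  have h5 : r ≤ |κ| / β * dist s t := by
    rw [div_mul_eq_mul_div, le_div_iff₀ hβ]
    rcases hr0.eq_or_lt with h0 | h0
    · rw [← h0]; simp; positivity
    · nlinarith
  rw [dist_eq_norm]
  calc ‖Z β s - Z β t‖ ≤ |κ| * r := norm_le_abs_mul_seminorm hN _
    _ ≤ |κ| * (|κ| / β * dist s t) := by gcongr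
    _ = |κ| * |κ| / β * dist s t := by ring

/-- The prox-mapping of a fixed prox-function. -/
theorem IsProxStructure.exists_isProxMap [CompleteSpace H] (hN : ∀ x, ‖x‖ ≤ κ * N x)
    (hd : IsProxStructure N Q d R) (hR : 0 ≤ R) (hne : Q.Nonempty) (hcl : IsClosed Q)
    (hQ : Convex ℝ Q) :
    ∃ (v : H → ℝ) (Z : ℝ → H → H → H), IsProxMap N Q (fun _ => v) Z ∧
      ∀ x ∈ Q, v x ≤ R ^ 2 / 2 := by
  obtain ⟨Z, hZ⟩ := hd.exists_continuous_argmin hN hR hne hcl hQ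
  obtain ⟨hm, -, h0⟩ := hZ 1 one_pos
  refine ⟨fun x => d x - d (Z 1 0), fun β _ s => Z β s, ⟨fun β hβ _ => (hZ β hβ).1, ?_, ?_, ?_⟩,
    fun x hx => hd.diam x hx _ (hm 0)⟩
  · exact fun β hβ => (hZ β hβ).2.1.comp continuous_snd
  · intro _ _ x hx
    have := h0 0 x hx
    simp only [inner_zero_left, one_mul] at this
    nlinarith [sq_nonneg (N (x - Z 1 0))]
  · intro β hβ _ _ s x hx
    have := (hZ β hβ).2.2 s x hx
    linarith

theorem isProxStructure_half_sq_norm {x₀ : H} (hx₀ : ∀ x ∈ Q, ‖x - x₀‖ ≤ R) :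
    IsProxStructure (normSeminorm ℝ H) Q (fun x => ‖x‖ ^ 2 / 2) (‖x₀‖ + R) where
  lsc := Continuous.lowerSemicontinuous (by fun_prop) |>.lowerSemicontinuousOn _
  strongConvex x _ y _ a b _ _ hab := by
    obtain rfl : b = 1 - a := by linarith
    simp only [coe_normSeminorm, norm_add_sq_real, norm_sub_sq_real, norm_smul, inner_smul_left,
      inner_smul_right, mul_pow, Real.norm_eq_abs, sq_abs, RCLike.conj_to_real]
    apply le_of_eq
    ring
  diam x hx y _ := by
    have h1 := hx₀ x hx
    have h2 : ‖x‖ ≤ ‖x₀‖ + ‖x - x₀‖ := norm_le_insert' x x₀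
    have h3 : ‖x‖ ^ 2 ≤ (‖x₀‖ + R) ^ 2 := by gcongr; linarith
    have h4 := sq_nonneg ‖y‖
    linarith

/-- The Euclidean prox-mappings with varying centre: moving the centre to `u` amounts to tilting
`‖x‖ ^ 2 / 2` by `⟨u, ·⟩`. -/
theorem exists_isProxMap_euclidean [CompleteSpace H] (hcl : IsClosed Q) (hQ : Convex ℝ Q)
    {x₀ : H} (hx₀Q : x₀ ∈ Q) (hR : 0 ≤ R) (hx₀ : ∀ x ∈ Q, ‖x - x₀‖ ≤ R) :
    ∃ Z : ℝ → H → H → H,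
      IsProxMap (normSeminorm ℝ H) Q (fun u x => ‖x - u‖ ^ 2 / 2) Z := by
  obtain ⟨Z, hZ⟩ := (isProxStructure_half_sq_norm hx₀).exists_continuous_argmin (κ := 1)
    (by simp) (by positivity) ⟨x₀, hx₀Q⟩ hcl hQ
  refine ⟨fun β u s => Z β (s - β • u), ⟨fun β hβ _ _ => (hZ β hβ).1 _, ?_, ?_, ?_⟩⟩
  · exact fun β hβ => (hZ β hβ).2.1.comp (by fun_prop)
  · intro _ _ _ _; positivity
  · intro β hβ u _ s x hx
    have := (hZ β hβ).2.2 (s - β • u) x hx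
    simp only [inner_sub_left, inner_smul_left, RCLike.conj_to_real] at this
    rw [norm_sub_sq_real, norm_sub_sq_real, real_inner_comm u x,
      real_inner_comm u (Z β (s - β • u))]
    linarith

end Prox

/-! ### Smoothness of functions with Hölder gradient -/

section Smoothness

theorem holderSmoothness_nonneg {Lν ν δ : ℝ} (hL : 0 ≤ Lν) (hν : 0 ≤ ν) (hν1 : ν ≤ 1)
    (hδ : 0 ≤ δ) : 0 ≤ holderSmoothness Lν ν δ := by
  have : 0 ≤ 1 - ν := by linarith
  unfold holderSmoothness
  positivity

/-- The product `δ L(δ)` is proportional to `δ ^ (2ν / (1 + ν))`. -/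
theorem mul_holderSmoothness_mono {Lν ν δ δ' : ℝ} (hL : 0 ≤ Lν) (hν : 0 ≤ ν) (hν1 : ν ≤ 1)
    (hδ : 0 < δ) (hδδ' : δ ≤ δ') :
    δ * holderSmoothness Lν ν δ ≤ δ' * holderSmoothness Lν ν δ' := by
  have h1 : 0 ≤ 1 - ν := by linarith
  have h2 : 0 ≤ (1 - ν) / (1 + ν) := by positivity
  have h3 : (1 - ν) / (1 + ν) ≤ 1 := by rw [div_le_one (by positivity)]; linarith
  have key : ∀ t : ℝ, 0 < t → t * holderSmoothness Lν ν t =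
      Lν * (Lν * (1 - ν) / (2 * (1 + ν))) ^ ((1 - ν) / (1 + ν)) *
        t ^ (1 - (1 - ν) / (1 + ν)) := by
    intro t ht
    have h4 : Lν * (1 - ν) / (2 * t * (1 + ν)) = Lν * (1 - ν) / (2 * (1 + ν)) * t⁻¹ := by
      field_simp
    rw [holderSmoothness, h4, Real.mul_rpow (by positivity) (by positivity),
      Real.inv_rpow ht.le, Real.rpow_sub ht, Real.rpow_one]
    ring
  rw [key δ hδ, key δ' (hδ.trans_le hδδ')]
  gcongr

/-- Young's inequality, with the constants of `holderSmoothness`. -/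
theorem mul_rpow_le_holderSmoothness {Lν ν δ r : ℝ} (hL : 0 ≤ Lν) (hν : 0 ≤ ν) (hν1 : ν ≤ 1)
    (hδ : 0 < δ) (hr : 0 ≤ r) :
    Lν * r ^ (1 + ν) ≤ (1 + ν) * (holderSmoothness Lν ν δ / 2 * r ^ 2 + δ) := by
  rcases hν1.eq_or_lt with rfl | hlt
  · norm_num [holderSmoothness]
    linarith
  have h1 : 0 < 1 - ν := by linarith
  set Λ := holderSmoothness Lν ν δ with hΛ
  have hΛ0 : 0 ≤ Λ := holderSmoothness_nonneg hL hν hν1 hδ.le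
  have key := Real.geom_mean_le_arith_mean2_weighted (w₁ := (1 + ν) / 2) (w₂ := (1 - ν) / 2)
    (p₁ := Λ * r ^ 2) (p₂ := 2 * δ * (1 + ν) / (1 - ν)) (by positivity) (by positivity)
    (by positivity) (by positivity) (by ring)
  have h2 : (r ^ 2) ^ ((1 + ν) / 2) = r ^ (1 + ν) := by
    rw [← Real.rpow_natCast, ← Real.rpow_mul hr]
    congr 1
    push_cast
    ring
  have h3 : Λ ^ ((1 + ν) / 2) * (2 * δ * (1 + ν) / (1 - ν)) ^ ((1 - ν) / 2) = Lν := by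
    rw [hΛ, holderSmoothness, Real.mul_rpow hL (by positivity), ← Real.rpow_mul (by positivity)]
    have e1 : (1 - ν) / (1 + ν) * ((1 + ν) / 2) = (1 - ν) / 2 := by field_simp
    rw [e1, mul_assoc, ← Real.mul_rpow (by positivity) (by positivity)]
    have e2 : Lν * (1 - ν) / (2 * δ * (1 + ν)) * (2 * δ * (1 + ν) / (1 - ν)) = Lν := by
      field_simp
    rw [e2, ← Real.rpow_add_of_nonneg hL (by positivity) (by positivity)]
    have e3 : (1 + ν) / 2 + (1 - ν) / 2 = 1 := by ring
    rw [e3, Real.rpow_one]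
  rw [Real.mul_rpow hΛ0 (by positivity), h2] at key
  have e4 : (1 - ν) / 2 * (2 * δ * (1 + ν) / (1 - ν)) = δ * (1 + ν) := by field_simp
  rw [e4] at key
  calc Lν * r ^ (1 + ν)
      = Λ ^ ((1 + ν) / 2) * r ^ (1 + ν) * (2 * δ * (1 + ν) / (1 - ν)) ^ ((1 - ν) / 2) := by
        rw [mul_right_comm, h3]
    _ ≤ _ := key
    _ = _ := by ring

end Smoothness

/-! ### Inexact first-order models -/

section Inexact

variable {H : Type*} [NormedAddCommGroup H] [InnerProductSpace ℝ H]

/-- A deterministic inexact first-order model of `f` on `Q`: the values `v x` and the gradients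
`g x` give a minorant of `f` at `x` whose error is at most `L / 2 ‖y - x‖ ^ 2 + δ`. -/
structure IsInexactModel (N : Seminorm ℝ H) (Q : Set H) (f v : H → ℝ) (g : H → H) (δ L : ℝ) :
    Prop where
  lower : ∀ x ∈ Q, ∀ y ∈ Q, v x + ⟪g x, y - x⟫ ≤ f y
  upper : ∀ x ∈ Q, ∀ y ∈ Q, f y ≤ v x + ⟪g x, y - x⟫ + (L / 2 * N (y - x) ^ 2 + δ)

variable {N : Seminorm ℝ H} {κ : ℝ} {Q : Set H} {f v : H → ℝ} {g : H → H}

/-- For a function with Hölder gradient, an inexact model of accuracy `δ` and constant `L(δ)` is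
also one for every larger accuracy `δ'` with the smaller constant `L(δ')`, up to absolute factors.
Near `x` the given bound is used as it is. Far from `x` the model error is convex along the segment
from `x` to `y`, so it is controlled by its values at the distances `√(δ / L(δ))` and
`2 √(δ / L(δ))`, where both terms of the bound are of order `δ`, and by the Hölder condition beyond
them. -/
theorem IsInexactModel.of_le_accuracy (hN : ∀ x, ‖x‖ ≤ κ * N x) (hQ : Convex ℝ Q)
    {Lν ν δ δ' : ℝ} (hL : 0 ≤ Lν) (hν : 0 ≤ ν) (hν1 : ν ≤ 1) (hδ : 0 < δ) (hδδ' : δ ≤ δ')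
    (hf : HasHolderGradient N Q f Lν ν)
    (hm : IsInexactModel N Q f v g δ (holderSmoothness Lν ν δ)) :
    IsInexactModel N Q f v g (5 * δ') (6 * holderSmoothness Lν ν δ') := by
  refine ⟨hm.lower, fun x hx y hy => ?_⟩
  obtain ⟨γ, hγ, hγL⟩ := hf
  have hδ' : 0 < δ' := hδ.trans_le hδδ'
  have hmono := mul_holderSmoothness_mono hL hν hν1 hδ hδδ'
  have hΛ0 := holderSmoothness_nonneg (δ := δ) hL hν hν1 hδ.le
  have hΛ0' := holderSmoothness_nonneg (δ := δ') hL hν hν1 hδ'.le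
  have hyoung := mul_rpow_le_holderSmoothness hL hν hν1 hδ' (apply_nonneg N (y - x))
  set Λ := holderSmoothness Lν ν δ
  set Λ' := holderSmoothness Lν ν δ'
  set r := N (y - x) with hr
  have hr0 : 0 ≤ r := apply_nonneg N _
  have hup := hm.upper x hx y hy
  by_cases hnear : Λ * r ^ 2 ≤ 4 * δ
  · have : 0 ≤ 6 * Λ' / 2 * r ^ 2 := by positivity
    linarith
  push Not at hnear
  have hΛ : 0 < Λ := by
    rcases hΛ0.eq_or_lt with h | h
    · rw [← h] at hnear; linarith
    · exact h
  have hrpos : 0 < r := by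
    rcases hr0.eq_or_lt with h | h
    · rw [← h] at hnear; linarith
    · exact h
  set t := √(δ / Λ) / r with ht
  have htpos : 0 < t := by positivity
  have ht2 : t ≤ 1 / 2 := by
    rw [ht, div_le_iff₀ hrpos, Real.sqrt_le_left (by positivity), div_le_iff₀ hΛ]
    linarith
  set σ := √(δ * Λ) with hσ
  have hσ0 : 0 ≤ σ := Real.sqrt_nonneg _
  have hσσ : σ * σ = δ * Λ := Real.mul_self_sqrt (by positivity)
  have hs : √(δ / Λ) * √(δ / Λ) = δ / Λ := Real.mul_self_sqrt (by positivity)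
  have hs1 : Λ * √(δ / Λ) = σ := by
    rw [hσ, show δ * Λ = Λ ^ 2 * (δ / Λ) by field_simp, Real.sqrt_mul (by positivity),
      Real.sqrt_sq hΛ0]
  -- both terms of the error bound at distance `√(δ / Λ)`, divided by `t`, equal `√(δ Λ) r`
  have htΛ : Λ * t * r ^ 2 = σ * r := by
    rw [ht, ← hs1]; field_simp
  have htδ : δ = t * (σ * r) := by
    rw [ht, ← hs1]
    have : √(δ / Λ) / r * (Λ * √(δ / Λ) * r) = Λ * (√(δ / Λ) * √(δ / Λ)) := by field_simp
    rw [this, hs]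
    field_simp
  have hz : x + t • (y - x) ∈ Q := hQ.add_smul_sub_mem hx hy ⟨htpos.le, by linarith⟩
  have hw : x + (2 * t) • (y - x) ∈ Q := hQ.add_smul_sub_mem hx hy ⟨by linarith, by linarith⟩
  set z := x + t • (y - x) with hzdef
  set w := x + (2 * t) • (y - x) with hwdef
  have hzx : z - x = t • (y - x) := by simp [hzdef]
  have hwx : w - x = (2 * t) • (y - x) := by simp [hwdef]
  have hwz : w - z = t • (y - x) := by rw [hzdef, hwdef]; module
  have hyz : y - z = (1 - t) • (y - x) := by rw [hzdef]; module
  have u1 := hm.upper x hx z hz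
  have u2 := hm.upper x hx w hw
  have l1 := hm.lower x hx z hz
  have c1 := hγ z hz w hw
  have c2 := hγ y hy z hz
  rw [hzx, inner_smul_right, map_smul_eq_mul, Real.norm_eq_abs, abs_of_pos htpos, ← hr] at u1
  rw [hwx, inner_smul_right, map_smul_eq_mul, Real.norm_eq_abs,
    abs_of_pos (by linarith : 0 < 2 * t), ← hr] at u2
  rw [hzx, inner_smul_right] at l1
  rw [hwz, inner_smul_right] at c1
  rw [← neg_sub, hyz, inner_neg_right, inner_smul_right] at c2
  have hold : ⟪γ y, y - x⟫ - ⟪γ z, y - x⟫ ≤ Lν * r ^ (1 + ν) := by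
    rw [← inner_sub_left]
    have h1 := inner_le_dualNorm_mul hN (γ y - γ z) (y - x)
    have h2 := hγL y hy z hz
    have h3 : N (y - z) ≤ r := by
      rw [hyz, map_smul_eq_mul, Real.norm_eq_abs, abs_of_nonneg (by linarith)]
      exact mul_le_of_le_one_left hr0 (by linarith)
    have h4 : N (y - z) ^ ν ≤ r ^ ν := Real.rpow_le_rpow (apply_nonneg N _) h3 hν
    calc _ ≤ dualNorm N (γ y - γ z) * r := h1
      _ ≤ (Lν * r ^ ν) * r := by
        gcongr
        exact h2.trans (by gcongr)
      _ = Lν * r ^ (1 + ν) := by rw [add_comm, Real.rpow_add_one hrpos.ne']; ring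
  set a := ⟪g x, y - x⟫
  set b := ⟪γ z, y - x⟫
  set e := ⟪γ y, y - x⟫
  have hpow : 0 ≤ Lν * r ^ (1 + ν) := by positivity
  -- the slope of the model error at `z` is at most its value at `w` divided by `t`
  have hslope : b - a ≤ 3 * (σ * r) := by
    have h1 : t * (b - a) ≤ Λ / 2 * (2 * t * r) ^ 2 + δ := by linarith
    have h2 : Λ / 2 * (2 * t * r) ^ 2 = t * (2 * (σ * r)) := by rw [← htΛ]; ring
    rw [h2] at h1
    have h3 : t * (b - a) ≤ t * (3 * (σ * r)) := by linarith
    exact le_of_mul_le_mul_left h3 htpos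
  have hu1 : Λ / 2 * (t * r) ^ 2 ≤ σ * r / 4 := by
    have : Λ / 2 * (t * r) ^ 2 = t * (σ * r) / 2 := by rw [← htΛ]; ring
    have h1 : t * (σ * r) ≤ 1 / 2 * (σ * r) := by gcongr
    linarith only [this, h1]
  have hsr : σ * r ≤ (δ' + Λ' * r ^ 2) / 2 := by
    have h1 : (σ * r) ^ 2 ≤ ((δ' + Λ' * r ^ 2) / 2) ^ 2 := by
      have h2 : (σ * r) ^ 2 ≤ δ' * Λ' * r ^ 2 := by
        rw [mul_pow, pow_two σ, hσσ]; gcongr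
      have h3 : ((δ' + Λ' * r ^ 2) / 2) ^ 2 - δ' * Λ' * r ^ 2 = ((δ' - Λ' * r ^ 2) / 2) ^ 2 := by
        ring
      have h4 := sq_nonneg ((δ' - Λ' * r ^ 2) / 2)
      linarith only [h2, h3, h4]
    exact le_of_sq_le_sq h1 (by positivity)
  have hmul1 : (1 - t) * (e - b) ≤ Lν * r ^ (1 + ν) := by
    calc (1 - t) * (e - b) ≤ (1 - t) * (Lν * r ^ (1 + ν)) := by gcongr; linarith
      _ ≤ Lν * r ^ (1 + ν) := mul_le_of_le_one_left hpow (by linarith)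
  have hmul2 : (1 - t) * (b - a) ≤ 3 * (σ * r) := by
    calc (1 - t) * (b - a) ≤ (1 - t) * (3 * (σ * r)) := by gcongr; linarith
      _ ≤ 3 * (σ * r) := mul_le_of_le_one_left (by positivity) (by linarith)
  have hy2 : (1 + ν) * (Λ' / 2 * r ^ 2 + δ') ≤ 2 * (Λ' / 2 * r ^ 2 + δ') := by
    gcongr; linarith
  have hΛr : 0 ≤ Λ' * r ^ 2 := by positivity
  linarith

end Inexact

/-! ### Weights -/

section Weights

/-- The weight `α_i` of the `i`-th gradient: it grows linearly, as in an accelerated method, until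
it reaches `1`, and stays constant from then on. The parameter `M` interpolates between the
non-accelerated method (`M = 1`) and the accelerated one (`M` of the order of the number of
iterations); it is the factor by which the oracle error is amplified. -/
noncomputable def stepWeight (M : ℝ) (i : ℕ) : ℝ := min 1 (((i : ℝ) + 2) / (2 * M))

/-- The sum `A_n` of the first `n` weights. -/
noncomputable def totalWeight (M : ℝ) (n : ℕ) : ℝ := ∑ i ∈ Finset.range n, stepWeight M i

variable {M : ℝ}

theorem stepWeight_le_one (i : ℕ) : stepWeight M i ≤ 1 := min_le_left _ _

theorem one_le_mul_stepWeight (hM : 1 ≤ M) (i : ℕ) : 1 ≤ M * stepWeight M i := by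
  have hM0 : 0 < M := by linarith
  rw [← div_le_iff₀' hM0, stepWeight, le_min_iff]
  refine ⟨by rwa [div_le_one hM0], ?_⟩
  rw [div_le_div_iff₀ hM0 (by positivity)]
  nlinarith [(Nat.cast_nonneg i : (0 : ℝ) ≤ i)]

theorem stepWeight_pos (hM : 1 ≤ M) (i : ℕ) : 0 < stepWeight M i :=
  pos_of_mul_pos_right (zero_lt_one.trans_le (one_le_mul_stepWeight hM i)) (by linarith)

theorem totalWeight_succ (n : ℕ) : totalWeight M (n + 1) = totalWeight M n + stepWeight M n :=
  Finset.sum_range_succ _ _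

theorem totalWeight_nonneg (hM : 1 ≤ M) (n : ℕ) : 0 ≤ totalWeight M n :=
  Finset.sum_nonneg fun i _ => (stepWeight_pos hM i).le

theorem totalWeight_succ_pos (hM : 1 ≤ M) (n : ℕ) : 0 < totalWeight M (n + 1) := by
  rw [totalWeight_succ]
  linarith [totalWeight_nonneg hM n, stepWeight_pos hM n]

theorem mul_sq_stepWeight_le_totalWeight (hM : 1 ≤ M) (i : ℕ) :
    M * stepWeight M i ^ 2 ≤ totalWeight M (i + 1) := by
  have hM0 : 0 < M := by linarith
  induction i with
  | zero =>
    have h1 : stepWeight M 0 = 1 / M := by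
      have h2 : 1 / M ≤ 1 := by rwa [div_le_one hM0]
      have h3 : ((0 : ℕ) + 2 : ℝ) / (2 * M) = 1 / M := by push_cast; field_simp; norm_num
      rw [stepWeight, h3, min_eq_right h2]
    rw [totalWeight, Finset.sum_range_one, h1]
    apply le_of_eq
    field_simp
  | succ k ih =>
    rw [totalWeight_succ]
    have h0 := stepWeight_pos hM k
    have hmono : stepWeight M k ≤ stepWeight M (k + 1) := by
      unfold stepWeight
      gcongr
      simp
    have hinc : stepWeight M (k + 1) ≤ stepWeight M k + 1 / (2 * M) := by
      unfold stepWeight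
      have h1 : 0 < 1 / (2 * M) := by positivity
      have h2 : (((k + 1 : ℕ) : ℝ) + 2) / (2 * M) = ((k : ℝ) + 2) / (2 * M) + 1 / (2 * M) := by
        push_cast; ring
      rw [h2, ← min_add_add_right]
      exact min_le_min (by linarith) le_rfl
    have h3 : M * (stepWeight M (k + 1) - stepWeight M k) ≤ 1 / 2 := by
      have : M * (1 / (2 * M)) = 1 / 2 := by field_simp
      nlinarith
    nlinarith

theorem div_four_le_totalWeight (hM : 1 ≤ M) {n : ℕ} (hn : M ≤ n) :
    (n : ℝ) / 4 ≤ totalWeight M n := by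
  have hM0 : 0 < M := by linarith
  have hn0 : (0 : ℝ) < n := by linarith
  have h1 : ∀ i ∈ Finset.range n, ((i : ℝ) + 1) / (2 * n) ≤ stepWeight M i := by
    intro i hi
    have hi' : (i : ℝ) + 1 ≤ n := by exact_mod_cast Finset.mem_range.1 hi
    refine le_min ?_ ?_
    · rw [div_le_one (by positivity)]; linarith
    · gcongr
      linarith
  have h2 : ∀ m : ℕ, (m : ℝ) ^ 2 / 2 ≤ ∑ i ∈ Finset.range m, ((i : ℝ) + 1) := by
    intro m
    induction m with
    | zero => simp
    | succ m ih => rw [Finset.sum_range_succ]; push_cast; nlinarith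
  calc (n : ℝ) / 4 = (n : ℝ) ^ 2 / 2 / (2 * n) := by field_simp; norm_num
    _ ≤ (∑ i ∈ Finset.range n, ((i : ℝ) + 1)) / (2 * n) := by gcongr; exact h2 n
    _ = ∑ i ∈ Finset.range n, ((i : ℝ) + 1) / (2 * n) := Finset.sum_div _ _ _
    _ ≤ totalWeight M n := Finset.sum_le_sum h1

end Weights

/-! ### One stage of the method -/

section Method

/-- The state `(x, z, s, u)` of the method: the approximate solution `x`, the prox-point `z`, the
weighted sum `s` of the gradients received since the last restart, the prox-centre `u`. -/
abbrev MethodState (H : Type*) := H × H × H × H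

variable {H : Type*} [NormedAddCommGroup H] [InnerProductSpace ℝ H]

/-- The point at which the `i`-th gradient after a restart is requested. -/
noncomputable def queryPoint (M : ℝ) (i : ℕ) (st : MethodState H) : H :=
  st.1 + (1 / (M * stepWeight M i)) • (st.2.1 - st.1)

/-- One iteration: the answer `G` enters the dual sum, the prox-point is recomputed, and the
approximate solution becomes the weighted mean of all prox-points computed so far. -/
noncomputable def iterStep (Z : ℝ → H → H → H) (M β : ℝ) (i : ℕ) (st : MethodState H) (G : H) :
    MethodState H :=
  let z' := Z β st.2.2.2 (st.2.2.1 + stepWeight M i • G)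
  (st.1 + (stepWeight M i / totalWeight M (i + 1)) • (z' - st.1), z',
    st.2.2.1 + stepWeight M i • G, st.2.2.2)

/-- The state in which the method starts afresh from the prox-centre `u`. -/
def freshState (Z : ℝ → H → H → H) (β : ℝ) (u : H) : MethodState H := (u, Z β u 0, 0, u)

/-- The points of the state that have to lie in `Q` do so. -/
def MethodState.Feasible (Q : Set H) (st : MethodState H) : Prop :=
  st.1 ∈ Q ∧ st.2.1 ∈ Q ∧ st.2.2.2 ∈ Q

variable {N : Seminorm ℝ H} {κ : ℝ} {Q : Set H} {V : H → H → ℝ} {Z : ℝ → H → H → H} {M β : ℝ}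

theorem queryPoint_mem (hQ : Convex ℝ Q) (hM : 1 ≤ M) (i : ℕ) {st : MethodState H}
    (hst : st.Feasible Q) : queryPoint M i st ∈ Q := by
  have h := one_le_mul_stepWeight hM i
  refine hQ.add_smul_sub_mem hst.1 hst.2.1 ⟨by positivity, ?_⟩
  rwa [div_le_one (by linarith)]

theorem feasible_iterStep (hQ : Convex ℝ Q) (hZ : IsProxMap N Q V Z) (hM : 1 ≤ M) (hβ : 0 < β)
    (i : ℕ) {st : MethodState H} (hst : st.Feasible Q) (G : H) :
    (iterStep Z M β i st G).Feasible Q := by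
  refine ⟨hQ.add_smul_sub_mem hst.1 (hZ.mem β hβ _ _) ⟨?_, ?_⟩, hZ.mem β hβ _ _, hst.2.2⟩
  · exact div_nonneg (stepWeight_pos hM i).le (totalWeight_nonneg hM _)
  · rw [div_le_one (totalWeight_succ_pos hM i), totalWeight_succ]
    linarith [totalWeight_nonneg hM i]

theorem feasible_freshState (hZ : IsProxMap N Q V Z) (hβ : 0 < β) {u : H} (hu : u ∈ Q) :
    (freshState Z β u).Feasible Q :=
  ⟨hu, hZ.mem β hβ _ _, hu⟩

theorem continuous_queryPoint (i : ℕ) : Continuous (queryPoint (H := H) M i) := by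
  unfold queryPoint
  fun_prop

theorem continuous_iterStep (hZ : IsProxMap N Q V Z) (hβ : 0 < β) (i : ℕ) :
    Continuous fun q : MethodState H × H => iterStep Z M β i q.1 q.2 := by
  have h1 : Continuous fun q : MethodState H × H =>
      Z β q.1.2.2.2 (q.1.2.2.1 + stepWeight M i • q.2) :=
    (hZ.continuous β hβ).comp
      (g := fun q : H × H => Z β q.1 q.2)
      (f := fun q : MethodState H × H => (q.1.2.2.2, q.1.2.2.1 + stepWeight M i • q.2))
      (by fun_prop)
  exact (continuous_fst.fst.add ((h1.sub continuous_fst.fst).const_smul _)).prodMk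
    (h1.prodMk (by fun_prop))

theorem continuous_freshState (hZ : IsProxMap N Q V Z) (hβ : 0 < β) :
    Continuous (freshState Z β) := by
  have h1 : Continuous fun u : H => Z β u 0 :=
    (hZ.continuous β hβ).comp (f := fun u : H => (u, (0 : H))) (by fun_prop)
  unfold freshState
  fun_prop

variable {f v : H → ℝ} {g : H → H} {δ L : ℝ}

/-- The decrease of the objective in one iteration. -/
theorem IsInexactModel.weighted_step (hQ : Convex ℝ Q) (hf : ConvexOn ℝ Q f)
    (hm : IsInexactModel N Q f v g δ L) (hM : 1 ≤ M) {x z z' : H} (hx : x ∈ Q)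
    (hz : z ∈ Q) (hz' : z' ∈ Q) (i : ℕ) {y : H}
    (hy : y = x + (1 / (M * stepWeight M i)) • (z - x)) :
    totalWeight M (i + 1) *
        f (x + (stepWeight M i / totalWeight M (i + 1)) • (z' - x)) ≤
      totalWeight M i * f x + stepWeight M i * (v y + ⟪g y, z' - y⟫) +
        L / (2 * M) * N (z' - z) ^ 2 + M * stepWeight M i ^ 2 * δ := by
  have hMα := one_le_mul_stepWeight hM i
  have hα := stepWeight_pos hM i
  have hA' := totalWeight_succ_pos hM i
  have hBA := mul_sq_stepWeight_le_totalWeight hM i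
  have hsucc := totalWeight_succ (M := M) i
  set α := stepWeight M i
  set A' := totalWeight M (i + 1)
  set A := totalWeight M i
  set B := M * α ^ 2 with hB
  have hM0 : 0 < M := by linarith
  have hB0 : 0 < B := by positivity
  set τ := 1 / (M * α) with hτ
  have hτ0 : 0 < τ := by positivity
  have hτ1 : τ ≤ 1 := by rwa [hτ, div_le_one (by positivity)]
  have hBτ : B * τ = α := by rw [hB, hτ]; field_simp
  have hyQ : y ∈ Q := by rw [hy]; exact hQ.add_smul_sub_mem hx hz ⟨hτ0.le, hτ1⟩
  set w := x + τ • (z' - x) with hw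
  have hwQ : w ∈ Q := hQ.add_smul_sub_mem hx hz' ⟨hτ0.le, hτ1⟩
  -- the new point is a convex combination of `x` and `w`
  have hconv : A' * f (x + (α / A') • (z' - x)) ≤ (A' - B) * f x + B * f w := by
    have h1 : x + (α / A') • (z' - x) = (1 - B / A') • x + (B / A') • w := by
      rw [hw, ← hBτ]
      module
    have h2 : B / A' ≤ 1 := by rwa [div_le_one hA']
    have h3 := hf.2 hx hwQ (sub_nonneg.2 h2) (by positivity : 0 ≤ B / A') (by ring)
    rw [h1]
    calc _ ≤ A' * ((1 - B / A') • f x + (B / A') • f w) := by gcongr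
      _ = _ := by simp only [smul_eq_mul]; field_simp
  have hwy : w - y = τ • (z' - z) := by rw [hw, hy]; module
  have hup := hm.upper y hyQ w hwQ
  have hlow := hm.lower y hyQ x hx
  have hdec : w - y = (1 - τ) • (x - y) + τ • (z' - y) := by rw [hw]; module
  have hin : ⟪g y, w - y⟫ = (1 - τ) * ⟪g y, x - y⟫ + τ * ⟪g y, z' - y⟫ := by
    rw [hdec, inner_add_right, inner_smul_right, inner_smul_right]
  rw [hin, hwy, map_smul_eq_mul, Real.norm_eq_abs, abs_of_pos hτ0] at hup
  have hup' := mul_le_mul_of_nonneg_left hup hB0.le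
  have hlow' := mul_le_mul_of_nonneg_left hlow
    (show 0 ≤ B - α by rw [← hBτ]; nlinarith)
  have hLB : B * (L / 2 * (τ * N (z' - z)) ^ 2) = L / (2 * M) * N (z' - z) ^ 2 := by
    rw [hB, hτ]; field_simp
  have e1 : B * (v y + ((1 - τ) * ⟪g y, x - y⟫ + τ * ⟪g y, z' - y⟫) +
      (L / 2 * (τ * N (z' - z)) ^ 2 + δ)) = (B - B * τ) * (v y + ⟪g y, x - y⟫) +
      B * τ * (v y + ⟪g y, z' - y⟫) + B * (L / 2 * (τ * N (z' - z)) ^ 2) + B * δ := by ring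
  rw [e1, hBτ, hLB] at hup'
  have e2 : (A' - B) * f x + (B - α) * f x = A * f x := by rw [hsucc]; ring
  linarith

/-- The error of the method after `n` iterations since a restart at `u`, for arbitrary answers
`G i` to the queries `y i`: the error of the prox-term, the accumulated error `δ` of the model, and
the contribution of the deviations `G i - g (y i)`. The proof shows that the potential
`A_i (f x_i - f x) + (β V u x + ⟨s_i, x⟩) - (β V u z_i + ⟨s_i, z_i⟩)` increases in each iteration
by at most the corresponding summand. -/
theorem IsInexactModel.error_le (hN : ∀ x, ‖x‖ ≤ κ * N x) (hQ : Convex ℝ Q)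
    (hf : ConvexOn ℝ Q f) (hm : IsInexactModel N Q f v g δ L) (hZ : IsProxMap N Q V Z)
    (hM : 1 ≤ M) (hβ : 0 < β) (hLβ : L / M ≤ β / 2) {u : H} (hu : u ∈ Q)
    (st : ℕ → MethodState H) (G y : ℕ → H) (h0 : st 0 = freshState Z β u)
    (hy : ∀ i, y i = queryPoint M i (st i))
    (hst : ∀ i, st (i + 1) = iterStep Z M β i (st i) (G i)) {x : H} (hx : x ∈ Q) (n : ℕ) :
    totalWeight M n * (f (st n).1 - f x) ≤ β * V u x + ∑ i ∈ Finset.range n,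
      (stepWeight M i * ⟪G i - g (y i), x - (st i).2.1⟫ + M * stepWeight M i ^ 2 * δ +
        stepWeight M i ^ 2 * dualNorm N (G i - g (y i)) ^ 2 / β) := by
  have hfeas : ∀ i, (st i).Feasible Q := by
    intro i
    induction i with
    | zero => rw [h0]; exact feasible_freshState hZ hβ hu
    | succ i ih => rw [hst]; exact feasible_iterStep hQ hZ hM hβ i ih _
  have hform : ∀ i, (st i).2.2.2 = u ∧ (st i).2.1 = Z β u (st i).2.2.1 := by
    intro i
    induction i with
    | zero => rw [h0]; exact ⟨rfl, rfl⟩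
    | succ i ih =>
      rw [hst]
      refine ⟨ih.1, ?_⟩
      simp only [iterStep, ih.1]
  have key : ∀ n, totalWeight M n * (f (st n).1 - f x) + (β * V u x + ⟪(st n).2.2.1, x⟫) -
      (β * V u (st n).2.1 + ⟪(st n).2.2.1, (st n).2.1⟫) ≤ β * V u x + ∑ i ∈ Finset.range n,
      (stepWeight M i * ⟪G i - g (y i), x - (st i).2.1⟫ + M * stepWeight M i ^ 2 * δ +
        stepWeight M i ^ 2 * dualNorm N (G i - g (y i)) ^ 2 / β) := by
    intro n
    induction n with
    | zero =>
      have h1 := mul_nonneg hβ.le (hZ.nonneg u hu _ (hZ.mem β hβ u 0))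
      simp [h0, freshState, totalWeight, h1]
    | succ n ih =>
      rw [Finset.sum_range_succ]
      obtain ⟨hx0, hz0, -⟩ := hfeas n
      obtain ⟨-, hz0', -⟩ := hfeas (n + 1)
      have hz := (hform n).2
      have hyn := hy n
      have hs' : (st (n + 1)).2.2.1 = (st n).2.2.1 + stepWeight M n • G n := by
        rw [hst]; rfl
      have hx' : (st (n + 1)).1 = (st n).1 +
          (stepWeight M n / totalWeight M (n + 1)) • ((st (n + 1)).2.1 - (st n).1) := by
        rw [hst]; rfl
      have hyQ : y n ∈ Q := by rw [hyn]; exact queryPoint_mem hQ hM n (hfeas n)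
      have hstep := hm.weighted_step hQ hf hM hx0 hz0 hz0' n hyn
      rw [← hx'] at hstep
      have hgrow := hZ.growth β hβ u hu (st n).2.2.1 _ hz0'
      rw [← hz] at hgrow
      have hlow := mul_le_mul_of_nonneg_left (hm.lower _ hyQ x hx) (stepWeight_pos hM n).le
      have hα := stepWeight_pos hM n
      rw [hs', totalWeight_succ]
      rw [totalWeight_succ] at hstep
      set α := stepWeight M n
      set z := (st n).2.1
      set z' := (st (n + 1)).2.1
      set s := (st n).2.2.1
      set η := G n - g (y n) with hη
      have hLM : L / (2 * M) * N (z' - z) ^ 2 ≤ β / 4 * N (z' - z) ^ 2 := by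
        have : L / (2 * M) = L / M / 2 := by field_simp
        rw [this]
        exact mul_le_mul_of_nonneg_right (by linarith) (sq_nonneg _)
      -- the quadratic term absorbs the deviation tested with `z' - z`
      have hdev : α * ⟪η, z - z'⟫ ≤ β / 4 * N (z' - z) ^ 2 + α ^ 2 * dualNorm N η ^ 2 / β := by
        have h1 := inner_le_dualNorm_mul hN η (z - z')
        rw [map_sub_rev] at h1
        have h2 : α * ⟪η, z - z'⟫ ≤ α * (dualNorm N η * N (z' - z)) := by gcongr
        have h3 : β / 4 * N (z' - z) ^ 2 + α ^ 2 * dualNorm N η ^ 2 / β -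
            α * (dualNorm N η * N (z' - z)) =
            (β * N (z' - z) / 2 - α * dualNorm N η) ^ 2 / β := by
          field_simp
          ring
        have h4 : 0 ≤ (β * N (z' - z) / 2 - α * dualNorm N η) ^ 2 / β := by positivity
        linarith
      have hG : G n = g (y n) + η := by rw [hη]; abel
      rw [hG]
      simp only [inner_add_left, inner_smul_left, inner_sub_right, RCLike.conj_to_real]
        at hstep hlow hdev ih ⊢
      linarith
  have h1 := key n
  have h2 := hZ.growth β hβ u hu (st n).2.2.1 x hx
  rw [← (hform n).2] at h2
  have h3 : 0 ≤ β / 2 * N (x - (st n).2.1) ^ 2 := by positivity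
  linarith

end Method

/-! ### Noise of the stochastic gradients -/

section Noise

/-- The law of a sequence of independent draws is unchanged when one of them is drawn anew. -/
theorem measurePreserving_update {Ξ : Type*} [MeasurableSpace Ξ] (P : Measure Ξ)
    [IsProbabilityMeasure P] (k : ℕ) :
    MeasurePreserving (fun q : (ℕ → Ξ) × Ξ => Function.update q.1 k q.2)
      ((Measure.infinitePi fun _ : ℕ => P).prod P) (Measure.infinitePi fun _ : ℕ => P) := by
  refine ⟨measurable_update', Measure.eq_infinitePi _ fun s t ht => ?_⟩
  have hpi : MeasurableSet (Set.pi (s : Set ℕ) t) :=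
    MeasurableSet.pi s.countable_toSet (fun i _ => ht i)
  rw [Measure.map_apply measurable_update' hpi]
  by_cases hk : k ∈ s
  · have h1 : (fun q : (ℕ → Ξ) × Ξ => Function.update q.1 k q.2) ⁻¹' (Set.pi (s : Set ℕ) t) =
        Set.pi ((s.erase k : Finset ℕ) : Set ℕ) t ×ˢ t k := by
      ext ⟨ω, a⟩
      simp only [Set.mem_preimage, Set.mem_pi, Set.mem_prod, Finset.mem_coe, Finset.mem_erase]
      constructor
      · intro h
        refine ⟨fun i hi => ?_, by simpa using h k hk⟩
        have := h i hi.2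
        rwa [Function.update_of_ne hi.1] at this
      · rintro ⟨h, ha⟩ i hi
        rcases eq_or_ne i k with rfl | hik
        · simpa using ha
        · rw [Function.update_of_ne hik]
          exact h i ⟨hik, hi⟩
    rw [h1, Measure.prod_prod, Measure.infinitePi_pi _ (fun i _ => ht i),
      Finset.prod_erase_mul _ _ hk]
  · have h1 : (fun q : (ℕ → Ξ) × Ξ => Function.update q.1 k q.2) ⁻¹' (Set.pi (s : Set ℕ) t) =
        Set.pi (s : Set ℕ) t ×ˢ Set.univ := by
      ext ⟨ω, a⟩
      simp only [Set.mem_preimage, Set.mem_pi, Set.mem_prod, Finset.mem_coe, Set.mem_univ,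
        and_true]
      refine forall₂_congr fun i hi => ?_
      rw [Function.update_of_ne (ne_of_mem_of_not_mem hi hk)]
    rw [h1, Measure.prod_prod, Measure.infinitePi_pi _ (fun i _ => ht i), measure_univ, mul_one]

variable {H Ξ : Type*} [NormedAddCommGroup H] [InnerProductSpace ℝ H]
  [MeasurableSpace H] [BorelSpace H] [MeasurableSpace Ξ] {N : Seminorm ℝ H} {κ : ℝ} {Q : Set H}
  {P : Measure Ξ} {φ F : H → Ξ → ℝ} {G : H → Ξ → H} {μ δ L D : ℝ}
  {y w : (ℕ → Ξ) → H} {k : ℕ}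

/-- The mean of the stochastic gradients at `x`. -/
noncomputable def meanGrad (P : Measure Ξ) (G : H → Ξ → H) (x : H) : H := ∫ ξ, G x ξ ∂P

theorem IsOracle.stronglyMeasurable_answer (hO : IsOracle N Q P φ F G μ δ L D)
    (hy : StronglyMeasurable y) (hyQ : ∀ ω, y ω ∈ Q) (k : ℕ) :
    StronglyMeasurable fun ω : ℕ → Ξ => G (y ω) (ω k) := by
  have h1 := hO.measurable_grad (Set.range y) (Set.range_subset_iff.2 hyQ) hy.isSeparable_range
  have h2 : Measurable fun ω : ℕ → Ξ => ((⟨y ω, ω, rfl⟩ : Set.range y), ω k) :=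
    (hy.measurable.subtype_mk).prodMk (measurable_pi_apply k)
  exact h1.comp_measurable h2

variable [IsProbabilityMeasure P]

theorem IsOracle.stronglyMeasurable_meanGrad (hO : IsOracle N Q P φ F G μ δ L D)
    (hy : StronglyMeasurable y) (hyQ : ∀ ω, y ω ∈ Q) :
    StronglyMeasurable fun ω : ℕ → Ξ => meanGrad P G (y ω) := by
  have h1 := hO.measurable_grad (Set.range y) (Set.range_subset_iff.2 hyQ) hy.isSeparable_range
  have h2 : Measurable fun ω : ℕ → Ξ => (⟨y ω, ω, rfl⟩ : Set.range y) := hy.measurable.subtype_mk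
  exact (StronglyMeasurable.integral_prod_right' (ν := P) h1).comp_measurable h2

/-- The deviation of the answer to a random query `y`, which is independent of the draw used for
the answer, has second moment at most `D`. -/
theorem IsOracle.integral_sq_dualNorm_le (hN : ∀ x, ‖x‖ ≤ κ * N x)
    (hO : IsOracle N Q P φ F G μ δ L D) (hD : 0 ≤ D) (hy : StronglyMeasurable y)
    (hyQ : ∀ ω, y ω ∈ Q) (hyk : ∀ ω a, y (Function.update ω k a) = y ω) :
    Integrable (fun ω => dualNorm N (G (y ω) (ω k) - meanGrad P G (y ω)) ^ 2)
      (Measure.infinitePi fun _ : ℕ => P) ∧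
    ∫ ω, dualNorm N (G (y ω) (ω k) - meanGrad P G (y ω)) ^ 2
      ∂(Measure.infinitePi fun _ : ℕ => P) ≤ D := by
  have hmeas : StronglyMeasurable
      fun ω : ℕ → Ξ => dualNorm N (G (y ω) (ω k) - meanGrad P G (y ω)) ^ 2 :=
    ((continuous_dualNorm hN).comp_stronglyMeasurable
      ((hO.stronglyMeasurable_answer hy hyQ k).sub (hO.stronglyMeasurable_meanGrad hy hyQ))).pow 2
  have hlint : ∫⁻ ω, ENNReal.ofReal (dualNorm N (G (y ω) (ω k) - meanGrad P G (y ω)) ^ 2)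
      ∂(Measure.infinitePi fun _ : ℕ => P) ≤ ENNReal.ofReal D := by
    have hm' : Measurable fun ω : ℕ → Ξ =>
        ENNReal.ofReal (dualNorm N (G (y ω) (ω k) - meanGrad P G (y ω)) ^ 2) :=
      hmeas.measurable.ennreal_ofReal
    have hc := hm'.comp (measurePreserving_update P k).measurable
    simp only [Function.comp_def, hyk, Function.update_self] at hc
    rw [← (measurePreserving_update P k).lintegral_comp hm']
    simp only [hyk, Function.update_self]
    rw [lintegral_prod _ hc.aemeasurable]
    calc _ ≤ ∫⁻ _ : ℕ → Ξ, ENNReal.ofReal D ∂(Measure.infinitePi fun _ : ℕ => P) := by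
          refine lintegral_mono fun ω => ?_
          have hi := hO.integrable_variance _ (hyQ ω)
          have hv := hO.variance_le _ (hyQ ω)
          simp only [meanGrad]
          rw [← ofReal_integral_eq_lintegral_ofReal hi
            (Filter.Eventually.of_forall fun _ => sq_nonneg _)]
          exact ENNReal.ofReal_le_ofReal hv
      _ = ENNReal.ofReal D := by simp
  have hint : Integrable (fun ω => dualNorm N (G (y ω) (ω k) - meanGrad P G (y ω)) ^ 2)
      (Measure.infinitePi fun _ : ℕ => P) := by
    refine ⟨hmeas.aestronglyMeasurable, ?_⟩
    rw [hasFiniteIntegral_iff_ofReal (Filter.Eventually.of_forall fun _ => sq_nonneg _)]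
    exact hlint.trans_lt ENNReal.ofReal_lt_top
  refine ⟨hint, ?_⟩
  rw [← ofReal_integral_eq_lintegral_ofReal hint
    (Filter.Eventually.of_forall fun _ => sq_nonneg _)] at hlint
  exact (ENNReal.ofReal_le_ofReal_iff hD).1 hlint

variable [CompleteSpace H]

/-- The deviation of the answer to a random query is orthogonal in mean to every bounded `w` that
is independent of the draw used for the answer. -/
theorem IsOracle.integral_inner_eq_zero (hN : ∀ x, ‖x‖ ≤ κ * N x)
    (hO : IsOracle N Q P φ F G μ δ L D) (hD : 0 ≤ D) (hy : StronglyMeasurable y)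
    (hyQ : ∀ ω, y ω ∈ Q) (hyk : ∀ ω a, y (Function.update ω k a) = y ω)
    (hw : StronglyMeasurable w) (hwk : ∀ ω a, w (Function.update ω k a) = w ω) {b : ℝ}
    (hwb : ∀ ω, N (w ω) ≤ b) :
    Integrable (fun ω => ⟪G (y ω) (ω k) - meanGrad P G (y ω), w ω⟫)
      (Measure.infinitePi fun _ : ℕ => P) ∧
    ∫ ω, ⟪G (y ω) (ω k) - meanGrad P G (y ω), w ω⟫
      ∂(Measure.infinitePi fun _ : ℕ => P) = 0 := by
  have hη := (hO.stronglyMeasurable_answer hy hyQ k).sub (hO.stronglyMeasurable_meanGrad hy hyQ)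
  have hmeas : StronglyMeasurable
      fun ω : ℕ → Ξ => ⟪G (y ω) (ω k) - meanGrad P G (y ω), w ω⟫ := hη.inner hw
  have hint : Integrable (fun ω => ⟪G (y ω) (ω k) - meanGrad P G (y ω), w ω⟫)
      (Measure.infinitePi fun _ : ℕ => P) := by
    refine (((hO.integral_sq_dualNorm_le hN hD hy hyQ hyk).1.add
      (integrable_const 1)).mul_const b).mono' hmeas.aestronglyMeasurable
      (Filter.Eventually.of_forall fun ω => ?_)
    have h1 := abs_inner_le_dualNorm_mul hN (G (y ω) (ω k) - meanGrad P G (y ω)) (w ω)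
    have hb : 0 ≤ b := (apply_nonneg N _).trans (hwb ω)
    set t := dualNorm N (G (y ω) (ω k) - meanGrad P G (y ω)) with ht
    have ht0 : 0 ≤ t := dualNorm_nonneg hN _
    calc ‖_‖ ≤ t * N (w ω) := h1
      _ ≤ t * b := mul_le_mul_of_nonneg_left (hwb ω) ht0
      _ ≤ (t ^ 2 + 1) * b := by gcongr; nlinarith [sq_nonneg (t - 1)]
  refine ⟨hint, ?_⟩
  have hmp := measurePreserving_update P k
  rw [← hmp.map_eq, integral_map hmp.measurable.aemeasurable
    (by rw [hmp.map_eq]; exact hmeas.aestronglyMeasurable)]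
  have hc := hmp.integrable_comp_of_integrable hint
  simp only [Function.comp_def, hyk, hwk, Function.update_self] at hc ⊢
  rw [integral_prod _ hc]
  refine integral_eq_zero_of_ae (Filter.Eventually.of_forall fun ω => ?_)
  have hi := hO.integrable_grad _ (hyQ ω)
  simp only [Pi.zero_apply]
  simp_rw [real_inner_comm (w ω)]
  simp_rw [inner_sub_right]
  rw [integral_sub (hi.const_inner _) (integrable_const _), integral_inner hi]
  simp [meanGrad]

end Noise

/-! ### Regularity of the objective -/

section Objective

variable {H : Type*} [NormedAddCommGroup H] [InnerProductSpace ℝ H] {N : Seminorm ℝ H} {κ : ℝ}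
  {Q : Set H} {f v : H → ℝ} {g : H → H} {L ν δ : ℝ}

theorem HasHolderGradient.convexOn (hQ : Convex ℝ Q) (hf : HasHolderGradient N Q f L ν) :
    ConvexOn ℝ Q f := by
  obtain ⟨γ, hγ, -⟩ := hf
  refine ⟨hQ, fun x hx y hy a b ha hb hab => ?_⟩
  have hz := hQ hx hy ha hb hab
  set z := a • x + b • y
  have h1 := mul_le_mul_of_nonneg_left (hγ z hz x hx) ha
  have h2 := mul_le_mul_of_nonneg_left (hγ z hz y hy) hb
  have h3 : a * ⟪γ z, x - z⟫ + b * ⟪γ z, y - z⟫ = 0 := by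
    have h4 : a • (x - z) + b • (y - z) = 0 := by
      rw [smul_sub, smul_sub, sub_add_sub_comm, ← add_smul, hab, one_smul, sub_self]
    rw [← inner_smul_right, ← inner_smul_right, ← inner_add_right, h4, inner_zero_right]
  have h5 : a * f z + b * f z = f z := by rw [← add_mul, hab, one_mul]
  simp only [smul_eq_mul]
  linarith

theorem HasHolderGradient.lowerSemicontinuousOn (hf : HasHolderGradient N Q f L ν) :
    LowerSemicontinuousOn f Q := by
  obtain ⟨γ, hγ, -⟩ := hf
  intro x hx c hc
  have h1 : Continuous fun y => f x + ⟪γ x, y - x⟫ := by fun_prop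
  have h2 := (h1.tendsto x).eventually (lt_mem_nhds (a := c) (by simpa using hc))
  filter_upwards [mem_nhdsWithin_of_mem_nhds h2, self_mem_nhdsWithin] with y hy hyQ
  exact lt_of_lt_of_le hy (hγ x hx y hyQ)

theorem IsInexactModel.exists_abs_le (hN : ∀ x, ‖x‖ ≤ κ * N x)
    (hm : IsInexactModel N Q f v g δ L) (hL : 0 ≤ L) {b : ℝ}
    (hb : ∀ x ∈ Q, ∀ y ∈ Q, N (x - y) ≤ b) : ∃ B, ∀ x ∈ Q, |f x| ≤ B := by
  rcases Q.eq_empty_or_nonempty with rfl | ⟨q, hq⟩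
  · exact ⟨0, by simp⟩
  refine ⟨|v q| + dualNorm N (g q) * b + (L / 2 * b ^ 2 + |δ|), fun y hy => ?_⟩
  have h1 := hm.lower q hq y hy
  have h2 := hm.upper q hq y hy
  have h3 := abs_inner_le_dualNorm_mul hN (g q) (y - q)
  have h4 := mul_le_mul_of_nonneg_left (hb y hy q hq) (dualNorm_nonneg hN (g q))
  have h5 : L / 2 * N (y - q) ^ 2 ≤ L / 2 * b ^ 2 := by
    have := hb y hy q hq
    gcongr
  have h6 := abs_le.1 (h3.trans h4)
  have h7 : 0 ≤ L / 2 * b ^ 2 := by positivity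
  rw [abs_le]
  constructor <;> linarith [neg_abs_le (v q), le_abs_self (v q), le_abs_self δ, abs_nonneg δ]

theorem measurable_comp_of_lowerSemicontinuousOn {X Ω : Type*} [TopologicalSpace X]
    [MeasurableSpace X] [BorelSpace X] [MeasurableSpace Ω] {Q : Set X} {f : X → ℝ} {u : Ω → X}
    (hf : LowerSemicontinuousOn f Q) (hu : Measurable u) (huQ : ∀ ω, u ω ∈ Q) : Measurable fun ω => f (u ω) := by
  refine measurable_of_Iic fun c => ?_
  obtain ⟨S, hS, hSQ⟩ := lowerSemicontinuousOn_iff_preimage_Iic.1 hf c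
  have h1 : (fun ω => f (u ω)) ⁻¹' Set.Iic c = u ⁻¹' S := by
    ext ω
    have h2 : u ω ∈ Q ∩ f ⁻¹' Set.Iic c ↔ u ω ∈ Q ∩ S := by rw [hSQ]
    simpa [huQ ω] using h2
  rw [h1]
  exact hu hS.measurableSet

end Objective

/-! ### The restarted method -/

section Restart

/-- The position `(j, i)` of the `k`-th oracle call: it is the `i`-th call of the `j`-th stage,
where stage `j` consists of `n j` calls. -/
def stageCounter (n : ℕ → ℕ) : ℕ → ℕ × ℕ
  | 0 => (0, 0)
  | k + 1 =>
    if (stageCounter n k).2 + 1 = n (stageCounter n k).1 then ((stageCounter n k).1 + 1, 0)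
    else ((stageCounter n k).1, (stageCounter n k).2 + 1)

/-- The number of oracle calls before stage `j`. -/
def stageStart (n : ℕ → ℕ) (j : ℕ) : ℕ := ∑ l ∈ Finset.range j, n l

theorem stageStart_succ (n : ℕ → ℕ) (j : ℕ) : stageStart n (j + 1) = stageStart n j + n j :=
  Finset.sum_range_succ _ _

theorem stageCounter_stageStart_add {n : ℕ → ℕ} (hn : ∀ j, 0 < n j) (j : ℕ) :
    ∀ i < n j, stageCounter n (stageStart n j + i) = (j, i) := by
  have hin : ∀ j, stageCounter n (stageStart n j) = (j, 0) →
      ∀ i < n j, stageCounter n (stageStart n j + i) = (j, i) := by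
    intro j h0 i
    induction i with
    | zero => intro _; exact h0
    | succ i ih =>
      intro hi
      rw [← add_assoc, stageCounter, ih (by omega), if_neg hi.ne]
  refine hin j ?_
  induction j with
  | zero => rfl
  | succ j ih =>
    have h1 := hin j ih (n j - 1) (by have := hn j; omega)
    have h2 : stageStart n (j + 1) = stageStart n j + (n j - 1) + 1 := by
      rw [stageStart_succ]; have := hn j; omega
    rw [h2, stageCounter, h1, if_pos (by have := hn j; simp; omega)]

/-- The parameters of the restarted method: the prox-mapping `Z`, the interpolation parameter `M`,
and, for each stage, the weight `β` of the prox-function and the number `n` of oracle calls; `u₀` is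
the first prox-centre. -/
structure RestartParams (H : Type*) where
  Z : ℝ → H → H → H
  M : ℝ
  β : ℕ → ℝ
  n : ℕ → ℕ
  u₀ : H

variable {H : Type*} [NormedAddCommGroup H] [InnerProductSpace ℝ H]

/-- The conditions on the parameters under which the restarted method is a method on `Q`. -/
structure RestartParams.Valid (A : RestartParams H) (N : Seminorm ℝ H) (Q : Set H)
    (V : H → H → ℝ) : Prop where
  convex : Convex ℝ Q
  prox : IsProxMap N Q V A.Z
  one_le : 1 ≤ A.M
  β_pos : ∀ j, 0 < A.β j
  n_pos : ∀ j, 0 < A.n j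
  mem : A.u₀ ∈ Q

/-- The state after the `k`-th oracle call. At the end of a stage the method restarts from its
approximate solution. -/
noncomputable def RestartParams.step (A : RestartParams H) (k : ℕ) (st : MethodState H) (G : H) :
    MethodState H :=
  let c := stageCounter A.n k
  let st' := iterStep A.Z A.M (A.β c.1) c.2 st G
  if c.2 + 1 = A.n c.1 then freshState A.Z (A.β (c.1 + 1)) st'.1 else st'

/-- The state as a function of the oracle answers; only the gradients enter. -/
noncomputable def RestartParams.state (A : RestartParams H) : List (ℝ × H) → MethodState H
  | [] => freshState A.Z (A.β 0) A.u₀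
  | a :: l => A.step l.length (A.state l) a.2

variable {N : Seminorm ℝ H} {κ : ℝ} {Q : Set H} {V : H → H → ℝ} {A : RestartParams H}

theorem RestartParams.Valid.feasible_step (hA : A.Valid N Q V) (k : ℕ) {st : MethodState H}
    (hst : st.Feasible Q) (G : H) : (A.step k st G).Feasible Q := by
  have h := feasible_iterStep hA.convex hA.prox hA.one_le (hA.β_pos (stageCounter A.n k).1)
    (stageCounter A.n k).2 hst G
  unfold RestartParams.step
  dsimp only
  split_ifs
  · exact feasible_freshState hA.prox (hA.β_pos _) h.1
  · exact h

theorem RestartParams.Valid.feasible_state (hA : A.Valid N Q V) (l : List (ℝ × H)) :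
    (A.state l).Feasible Q := by
  induction l with
  | nil => exact feasible_freshState hA.prox (hA.β_pos _) hA.mem
  | cons a l ih => exact hA.feasible_step _ ih _

theorem RestartParams.Valid.continuous_step (hA : A.Valid N Q V) (k : ℕ) :
    Continuous fun q : MethodState H × H => A.step k q.1 q.2 := by
  have h := continuous_iterStep hA.prox (M := A.M) (hA.β_pos (stageCounter A.n k).1)
    (stageCounter A.n k).2
  unfold RestartParams.step
  dsimp only
  split_ifs
  · exact (continuous_freshState hA.prox (hA.β_pos _)).comp h.fst
  · exact h

/-- The restarted method. Its output is the centre of the last restart. -/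
noncomputable def RestartParams.Valid.method (hA : A.Valid N Q V) : OracleMethod Q where
  query l := queryPoint A.M (stageCounter A.n l.length).2 (A.state l)
  output l := (A.state l).2.2.2
  query_mem l := queryPoint_mem hA.convex hA.one_le _ (hA.feasible_state l)
  output_mem l := (hA.feasible_state l).2.2

theorem OracleMethod.length_answers {H Ξ : Type*} {Q : Set H} (A : OracleMethod Q)
    (F : H → Ξ → ℝ) (G : H → Ξ → H) (ξ : ℕ → Ξ) (k : ℕ) : (A.answers F G ξ k).length = k := by
  induction k with
  | zero => rfl
  | succ k ih => simp [OracleMethod.answers, ih]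

theorem OracleMethod.answers_update {H Ξ : Type*} {Q : Set H} (A : OracleMethod Q)
    (F : H → Ξ → ℝ) (G : H → Ξ → H) (ξ : ℕ → Ξ) {k l : ℕ} (hkl : k ≤ l) (a : Ξ) :
    A.answers F G (Function.update ξ l a) k = A.answers F G ξ k := by
  induction k with
  | zero => rfl
  | succ k ih =>
    simp only [OracleMethod.answers]
    rw [ih (by omega), Function.update_of_ne (by omega)]

variable {Ξ : Type*} {F : H → Ξ → ℝ} {G : H → Ξ → H}

/-- The state of the method after `k` oracle calls with the draws `ω`. -/
noncomputable def RestartParams.Valid.traj (hA : A.Valid N Q V) (F : H → Ξ → ℝ) (G : H → Ξ → H)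
    (k : ℕ) (ω : ℕ → Ξ) : MethodState H :=
  A.state (hA.method.answers F G ω k)

theorem RestartParams.Valid.feasible_traj (hA : A.Valid N Q V) (k : ℕ) (ω : ℕ → Ξ) :
    (hA.traj F G k ω).Feasible Q :=
  hA.feasible_state _

theorem RestartParams.Valid.traj_succ (hA : A.Valid N Q V) (k : ℕ) (ω : ℕ → Ξ) :
    hA.traj F G (k + 1) ω = A.step k (hA.traj F G k ω)
      (G (queryPoint A.M (stageCounter A.n k).2 (hA.traj F G k ω)) (ω k)) := by
  simp only [RestartParams.Valid.traj, OracleMethod.answers, RestartParams.state,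
    OracleMethod.length_answers]
  simp only [RestartParams.Valid.method, OracleMethod.length_answers]

theorem RestartParams.Valid.traj_update (hA : A.Valid N Q V) {k l : ℕ} (hkl : k ≤ l)
    (ω : ℕ → Ξ) (a : Ξ) : hA.traj F G k (Function.update ω l a) = hA.traj F G k ω := by
  rw [RestartParams.Valid.traj, OracleMethod.answers_update _ _ _ _ hkl]
  rfl

/-- The iterates of the stage that begins with oracle call `t` at the prox-centre `u`. -/
noncomputable def stageIterate (Z : ℝ → H → H → H) (M β : ℝ) (G : H → Ξ → H) (t : ℕ) (u : H)
    (ω : ℕ → Ξ) : ℕ → MethodState H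
  | 0 => freshState Z β u
  | i + 1 => iterStep Z M β i (stageIterate Z M β G t u ω i)
      (G (queryPoint M i (stageIterate Z M β G t u ω i)) (ω (t + i)))

/-- The prox-centre of stage `j`. -/
noncomputable def RestartParams.Valid.centre (hA : A.Valid N Q V) (F : H → Ξ → ℝ)
    (G : H → Ξ → H) (j : ℕ) (ω : ℕ → Ξ) : H :=
  (hA.traj F G (stageStart A.n j) ω).2.2.2

theorem RestartParams.Valid.centre_mem (hA : A.Valid N Q V) (j : ℕ) (ω : ℕ → Ξ) :
    hA.centre F G j ω ∈ Q :=
  (hA.feasible_traj _ _).2.2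

theorem RestartParams.Valid.centre_zero (hA : A.Valid N Q V) (ω : ℕ → Ξ) :
    hA.centre F G 0 ω = A.u₀ :=
  rfl

theorem RestartParams.Valid.traj_eq_stageIterate (hA : A.Valid N Q V) (j : ℕ) (ω : ℕ → Ξ)
    (h0 : hA.traj F G (stageStart A.n j) ω = freshState A.Z (A.β j) (hA.centre F G j ω)) :
    ∀ i < A.n j, hA.traj F G (stageStart A.n j + i) ω =
      stageIterate A.Z A.M (A.β j) G (stageStart A.n j) (hA.centre F G j ω) ω i := by
  intro i
  induction i with
  | zero => intro _; exact h0
  | succ i ih =>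
    intro hi
    rw [← add_assoc, hA.traj_succ, ih (by omega), RestartParams.step,
      stageCounter_stageStart_add hA.n_pos j i (by omega)]
    exact if_neg hi.ne

theorem RestartParams.Valid.traj_stageStart_succ (hA : A.Valid N Q V) (j : ℕ) (ω : ℕ → Ξ)
    (h0 : hA.traj F G (stageStart A.n j) ω = freshState A.Z (A.β j) (hA.centre F G j ω)) :
    hA.traj F G (stageStart A.n (j + 1)) ω = freshState A.Z (A.β (j + 1))
      (stageIterate A.Z A.M (A.β j) G (stageStart A.n j) (hA.centre F G j ω) ω (A.n j)).1 := by
  obtain ⟨m, hm⟩ : ∃ m, A.n j = m + 1 := ⟨A.n j - 1, by have := hA.n_pos j; omega⟩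
  rw [stageStart_succ, hm, ← add_assoc, hA.traj_succ,
    hA.traj_eq_stageIterate j ω h0 m (by omega), RestartParams.step,
    stageCounter_stageStart_add hA.n_pos j m (by omega)]
  exact if_pos hm.symm

theorem RestartParams.Valid.traj_stageStart (hA : A.Valid N Q V) (j : ℕ) (ω : ℕ → Ξ) :
    hA.traj F G (stageStart A.n j) ω = freshState A.Z (A.β j) (hA.centre F G j ω) := by
  cases j with
  | zero => rfl
  | succ j =>
    induction j with
    | zero =>
      have h := hA.traj_stageStart_succ (F := F) (G := G) 0 ω rfl
      rw [RestartParams.Valid.centre, h]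
      rfl
    | succ j ih =>
      have h := hA.traj_stageStart_succ (j + 1) ω ih
      rw [RestartParams.Valid.centre, h]
      rfl

theorem RestartParams.Valid.centre_succ (hA : A.Valid N Q V) (j : ℕ) (ω : ℕ → Ξ) :
    hA.centre F G (j + 1) ω =
      (stageIterate A.Z A.M (A.β j) G (stageStart A.n j) (hA.centre F G j ω) ω (A.n j)).1 := by
  rw [RestartParams.Valid.centre, hA.traj_stageStart_succ j ω (hA.traj_stageStart j ω)]
  rfl

variable [MeasurableSpace H] [BorelSpace H] [MeasurableSpace Ξ] {P : Measure Ξ}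
  {φ : H → Ξ → ℝ} {μ δ L D δ' L' : ℝ}

theorem RestartParams.Valid.stronglyMeasurable_traj (hA : A.Valid N Q V)
    (hO : IsOracle N Q P φ F G μ δ L D) (k : ℕ) : StronglyMeasurable (hA.traj F G k) := by
  induction k with
  | zero => exact stronglyMeasurable_const
  | succ k ih =>
    have h1 : StronglyMeasurable fun ω =>
        queryPoint A.M (stageCounter A.n k).2 (hA.traj F G k ω) :=
      (continuous_queryPoint _).comp_stronglyMeasurable ih
    have h2 := hO.stronglyMeasurable_answer h1
      (fun ω => queryPoint_mem hA.convex hA.one_le _ (hA.feasible_traj k ω)) k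
    have h3 := (hA.continuous_step k).comp_stronglyMeasurable (ih.prodMk h2)
    have h4 : hA.traj F G (k + 1) = _ := funext (hA.traj_succ k)
    rw [h4]
    exact h3

theorem RestartParams.Valid.stronglyMeasurable_centre (hA : A.Valid N Q V)
    (hO : IsOracle N Q P φ F G μ δ L D) (j : ℕ) : StronglyMeasurable (hA.centre F G j) :=
  (by fun_prop : Continuous fun st : MethodState H => st.2.2.2).comp_stronglyMeasurable
    (hA.stronglyMeasurable_traj hO _)

variable [CompleteSpace H] [IsProbabilityMeasure P]

/-- The expected error at the end of a stage. In `IsInexactModel.error_le` the deviations of the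
stochastic gradients enter linearly through a term of mean zero, and quadratically. -/
theorem RestartParams.Valid.integral_centre_succ_le (hA : A.Valid N Q V)
    (hN : ∀ x, ‖x‖ ≤ κ * N x) (hO : IsOracle N Q P φ F G μ δ L D) (hD : 0 ≤ D) {b : ℝ}
    (hb : ∀ x ∈ Q, ∀ y ∈ Q, N (x - y) ≤ b) {f v : H → ℝ} (hf : ConvexOn ℝ Q f)
    (hm : IsInexactModel N Q f v (meanGrad P G) δ' L') (hδ' : 0 ≤ δ') {j : ℕ}
    (hLβ : L' / A.M ≤ A.β j / 2) (hMn : A.M ≤ A.n j)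
    (hfint : Integrable (fun ω => f (hA.centre F G (j + 1) ω))
      (Measure.infinitePi fun _ : ℕ => P))
    {x : H} (hx : x ∈ Q)
    (hVint : Integrable (fun ω => V (hA.centre F G j ω) x) (Measure.infinitePi fun _ : ℕ => P))
    {r : ℝ} (hV : ∫ ω, V (hA.centre F G j ω) x ∂(Measure.infinitePi fun _ : ℕ => P) ≤ r) :
    (∫ ω, f (hA.centre F G (j + 1) ω) ∂(Measure.infinitePi fun _ : ℕ => P)) - f x ≤
      4 * A.β j * r / A.n j + A.M * δ' + D / A.β j := by
  set t := stageStart A.n j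
  set st : (ℕ → Ξ) → ℕ → MethodState H :=
    fun ω => stageIterate A.Z A.M (A.β j) G t (hA.centre F G j ω) ω with hst
  set y : ℕ → (ℕ → Ξ) → H := fun i ω => queryPoint A.M i (st ω i) with hy
  set η : ℕ → (ℕ → Ξ) → H := fun i ω => G (y i ω) (ω (t + i)) - meanGrad P G (y i ω) with hη
  have hβ := hA.β_pos j
  have hn0 : (0 : ℝ) < A.n j := by exact_mod_cast hA.n_pos j
  have hpath : ∀ ω, totalWeight A.M (A.n j) * (f (hA.centre F G (j + 1) ω) - f x) ≤
      A.β j * V (hA.centre F G j ω) x + ∑ i ∈ Finset.range (A.n j),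
        (stepWeight A.M i * ⟪η i ω, x - (st ω i).2.1⟫ + A.M * stepWeight A.M i ^ 2 * δ' +
          stepWeight A.M i ^ 2 * dualNorm N (η i ω) ^ 2 / A.β j) := by
    intro ω
    rw [hA.centre_succ]
    exact hm.error_le hN hA.convex hf hA.prox hA.one_le hβ hLβ (hA.centre_mem j ω) (st ω)
      (fun i => G (y i ω) (ω (t + i))) (fun i => y i ω) rfl (fun _ => rfl) (fun _ => rfl) hx
      (A.n j)
  have hsteq : ∀ i < A.n j, (fun ω => st ω i) = hA.traj F G (t + i) := fun i hi =>
    funext fun ω => (hA.traj_eq_stageIterate j ω (hA.traj_stageStart j ω) i hi).symm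
  have hmeas : ∀ i < A.n j, StronglyMeasurable fun ω => st ω i := fun i hi => by
    rw [hsteq i hi]; exact hA.stronglyMeasurable_traj hO _
  have hupd : ∀ i < A.n j, ∀ ω a, st (Function.update ω (t + i) a) i = st ω i := by
    intro i hi ω a
    have h := hsteq i hi
    rw [show st ω i = hA.traj F G (t + i) ω from congrFun h ω,
      show st (Function.update ω (t + i) a) i = _ from congrFun h _, hA.traj_update le_rfl]
  have hfeas : ∀ i < A.n j, ∀ ω, (st ω i).Feasible Q := by
    intro i hi ω
    rw [show st ω i = hA.traj F G (t + i) ω from congrFun (hsteq i hi) ω]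
    exact hA.feasible_traj _ _
  have hymeas : ∀ i < A.n j, StronglyMeasurable (y i) := fun i hi =>
    (continuous_queryPoint i).comp_stronglyMeasurable (hmeas i hi)
  have hyQ : ∀ i < A.n j, ∀ ω, y i ω ∈ Q := fun i hi ω =>
    queryPoint_mem hA.convex hA.one_le i (hfeas i hi ω)
  have hyk : ∀ i < A.n j, ∀ ω a, y i (Function.update ω (t + i) a) = y i ω := fun i hi ω a => by
    simp only [hy, hupd i hi]
  have hlin : ∀ i < A.n j, Integrable (fun ω => ⟪η i ω, x - (st ω i).2.1⟫)
      (Measure.infinitePi fun _ : ℕ => P) ∧ ∫ ω, ⟪η i ω, x - (st ω i).2.1⟫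
        ∂(Measure.infinitePi fun _ : ℕ => P) = 0 := fun i hi =>
    hO.integral_inner_eq_zero hN hD (hymeas i hi) (hyQ i hi) (hyk i hi)
      (w := fun ω => x - (st ω i).2.1)
      ((by fun_prop : Continuous fun s : MethodState H => x - s.2.1).comp_stronglyMeasurable
        (hmeas i hi))
      (fun ω a => by simp only [hupd i hi]) (fun ω => hb x hx _ (hfeas i hi ω).2.1)
  have hsq : ∀ i < A.n j, Integrable (fun ω => dualNorm N (η i ω) ^ 2)
      (Measure.infinitePi fun _ : ℕ => P) ∧ ∫ ω, dualNorm N (η i ω) ^ 2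
        ∂(Measure.infinitePi fun _ : ℕ => P) ≤ D := fun i hi =>
    hO.integral_sq_dualNorm_le hN hD (hymeas i hi) (hyQ i hi) (hyk i hi)
  have hterm : ∀ i ∈ Finset.range (A.n j), Integrable (fun ω =>
      stepWeight A.M i * ⟪η i ω, x - (st ω i).2.1⟫ + A.M * stepWeight A.M i ^ 2 * δ' +
        stepWeight A.M i ^ 2 * dualNorm N (η i ω) ^ 2 / A.β j)
      (Measure.infinitePi fun _ : ℕ => P) := fun i hi => by
    have hi' := Finset.mem_range.1 hi
    exact (((hlin i hi').1.const_mul _).add (integrable_const _)).add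
      (((hsq i hi').1.const_mul _).div_const _)
  have hmain := integral_mono ((hfint.sub (integrable_const (f x))).const_mul _)
    ((hVint.const_mul _).add (integrable_finsetSum _ hterm)) hpath
  simp only [Pi.sub_apply, Pi.add_apply] at hmain
  rw [integral_const_mul, integral_sub hfint (integrable_const _),
    integral_add (hVint.const_mul _) (integrable_finsetSum _ hterm), integral_const_mul,
    integral_finsetSum _ hterm] at hmain
  have hsum : ∑ i ∈ Finset.range (A.n j), ∫ ω,
      (stepWeight A.M i * ⟪η i ω, x - (st ω i).2.1⟫ + A.M * stepWeight A.M i ^ 2 * δ' +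
        stepWeight A.M i ^ 2 * dualNorm N (η i ω) ^ 2 / A.β j)
      ∂(Measure.infinitePi fun _ : ℕ => P) ≤
      ∑ i ∈ Finset.range (A.n j), stepWeight A.M i * (A.M * δ' + D / A.β j) := by
    refine Finset.sum_le_sum fun i hi => ?_
    have hi' := Finset.mem_range.1 hi
    have hI : Integrable (fun ω => stepWeight A.M i * ⟪η i ω, x - (st ω i).2.1⟫ +
        A.M * stepWeight A.M i ^ 2 * δ') (Measure.infinitePi fun _ : ℕ => P) :=
      ((hlin i hi').1.const_mul _).add (integrable_const _)
    rw [integral_add hI (((hsq i hi').1.const_mul _).div_const _),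
      integral_add ((hlin i hi').1.const_mul _) (integrable_const _),
      integral_const_mul (stepWeight A.M i), (hlin i hi').2, integral_div,
      integral_const_mul (stepWeight A.M i ^ 2)]
    have hα := stepWeight_pos hA.one_le i
    have hα2 : stepWeight A.M i ^ 2 ≤ stepWeight A.M i := by
      rw [pow_two]; exact mul_le_of_le_one_left hα.le (stepWeight_le_one i)
    have hM := hA.one_le
    have h1 : stepWeight A.M i ^ 2 * ∫ ω, dualNorm N (η i ω) ^ 2
        ∂(Measure.infinitePi fun _ : ℕ => P) ≤ stepWeight A.M i * D :=
      mul_le_mul hα2 (hsq i hi').2 (integral_nonneg fun _ => sq_nonneg _) hα.le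
    have h2 : A.M * stepWeight A.M i ^ 2 * δ' ≤ A.M * stepWeight A.M i * δ' := by gcongr
    have h3 : (stepWeight A.M i ^ 2 * ∫ ω, dualNorm N (η i ω) ^ 2
        ∂(Measure.infinitePi fun _ : ℕ => P)) / A.β j ≤ stepWeight A.M i * D / A.β j := by
      gcongr
    simp only [integral_const, probReal_univ, one_smul, mul_zero, zero_add]
    calc _ ≤ A.M * stepWeight A.M i * δ' + stepWeight A.M i * D / A.β j := add_le_add h2 h3
      _ = _ := by ring
  rw [← Finset.sum_mul] at hsum
  change _ ≤ totalWeight A.M (A.n j) * _ at hsum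
  have hAn := div_four_le_totalWeight hA.one_le hMn
  set W := totalWeight A.M (A.n j)
  have hW : 0 < W := by linarith [div_pos hn0 (by norm_num : (0 : ℝ) < 4)]
  have hr : 0 ≤ r := (integral_nonneg fun ω => hA.prox.nonneg _ (hA.centre_mem j ω) x hx).trans hV
  have h1 : A.β j * ∫ ω, V (hA.centre F G j ω) x ∂(Measure.infinitePi fun _ : ℕ => P) ≤
      W * (4 * A.β j * r / A.n j) := by
    calc _ ≤ A.β j * r := by gcongr
      _ = A.n j / 4 * (4 * A.β j * r / A.n j) := by field_simp
      _ ≤ _ := by gcongr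
  simp only [integral_const, probReal_univ, one_smul] at hmain
  refine le_of_mul_le_mul_left ?_ hW
  linarith

end Restart

/-! ### The iteration rate -/

section Rate

/-- The common part of the two complexity bounds: up to absolute factors, the number of iterations
in which a method divides the error of a problem by `4`, when `μ` is the modulus of strong
convexity relative to the prox-function. In the merely convex case `ε / R ^ 2` takes the place of
`μ`. -/
noncomputable def iterationRate (p ν Lν μ ε : ℝ) : ℝ :=
  max 1 ((Lν ^ (2 / (1 + ν)) / (μ * ε ^ ((1 - ν) / (1 + ν)))) ^ ((1 + ν) / (1 + 2 * p * ν + ν)))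

theorem one_le_iterationRate (p ν Lν μ ε : ℝ) : 1 ≤ iterationRate p ν Lν μ ε := le_max_left _ _

theorem convexRate_eq_iterationRate {p ν Lν R ε : ℝ} (hν : 0 ≤ ν) (hL : 0 ≤ Lν) (hR : 0 < R)
    (hε : 0 < ε) : convexRate p ν Lν R ε = iterationRate p ν Lν (ε / R ^ 2) ε := by
  have h1 : (Lν * R ^ (1 + ν) / ε) ^ (2 / (1 + 2 * p * ν + ν)) =
      ((Lν * R ^ (1 + ν) / ε) ^ (2 / (1 + ν))) ^ ((1 + ν) / (1 + 2 * p * ν + ν)) := by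
    rw [← Real.rpow_mul (by positivity)]
    congr 1
    field_simp
  have h2 : (Lν * R ^ (1 + ν) / ε) ^ (2 / (1 + ν)) =
      Lν ^ (2 / (1 + ν)) / (ε / R ^ 2 * ε ^ ((1 - ν) / (1 + ν))) := by
    have h3 : ε ^ (2 / (1 + ν)) = ε * ε ^ ((1 - ν) / (1 + ν)) := by
      rw [← Real.rpow_one_add' hε.le (by field_simp; norm_num; positivity)]
      congr 1
      field_simp
      norm_num
    have h4 : (R ^ (1 + ν)) ^ (2 / (1 + ν)) = R ^ 2 := by
      rw [← Real.rpow_mul hR.le, ← Real.rpow_natCast]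
      congr 1
      field_simp
      norm_num
    rw [Real.div_rpow (by positivity) hε.le, Real.mul_rpow hL (by positivity), h3, h4]
    field_simp
  rw [convexRate, iterationRate, h1, h2]

/-- The smoothness constant at the accuracy that is amplified to `ε / 20` by the factor `K ^ p`,
for `K` the iteration rate. -/
theorem holderSmoothness_le_iterationRate {p ν Lν μ ε : ℝ} (hp : 0 ≤ p) (hν : 0 ≤ ν)
    (hν1 : ν ≤ 1) (hL : 0 ≤ Lν) (hμ : 0 < μ) (hε : 0 < ε) :
    holderSmoothness Lν ν (ε / (20 * iterationRate p ν Lν μ ε ^ p)) ≤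
      10 * μ * iterationRate p ν Lν μ ε * iterationRate p ν Lν μ ε ^ p := by
  have hK1 := one_le_iterationRate p ν Lν μ ε
  have hKX : (Lν ^ (2 / (1 + ν)) / (μ * ε ^ ((1 - ν) / (1 + ν)))) ^
      ((1 + ν) / (1 + 2 * p * ν + ν)) ≤ iterationRate p ν Lν μ ε := le_max_right _ _
  set K := iterationRate p ν Lν μ ε
  set e := (1 - ν) / (1 + ν) with he
  set X := Lν ^ (2 / (1 + ν)) / (μ * ε ^ e) with hX
  have h1ν : 0 ≤ 1 - ν := by linarith
  have hK0 : 0 < K := by linarith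
  have he0 : 0 ≤ e := by positivity
  have he1 : e ≤ 1 := by rw [he, div_le_one (by positivity)]; linarith
  have hX0 : 0 ≤ X := by positivity
  have hXK : X ≤ K ^ ((1 + 2 * p * ν + ν) / (1 + ν)) := by
    calc X = (X ^ ((1 + ν) / (1 + 2 * p * ν + ν))) ^ ((1 + 2 * p * ν + ν) / (1 + ν)) := by
          rw [← Real.rpow_mul hX0]
          have : (1 + ν) / (1 + 2 * p * ν + ν) * ((1 + 2 * p * ν + ν) / (1 + ν)) = 1 := by
            have : 1 + 2 * p * ν + ν ≠ 0 := by positivity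
            field_simp
          rw [this, Real.rpow_one]
      _ ≤ _ := Real.rpow_le_rpow (by positivity) hKX (by positivity)
  have h1 : Lν * (1 - ν) / (2 * (ε / (20 * K ^ p)) * (1 + ν)) ≤ 10 * (Lν * K ^ p / ε) := by
    have h2 : Lν * (1 - ν) / (2 * (ε / (20 * K ^ p)) * (1 + ν)) =
        10 * (Lν * K ^ p / ε) * e := by
      rw [he]; field_simp; ring
    rw [h2]
    exact mul_le_of_le_one_right (by positivity) he1
  have h10 : (10 : ℝ) ^ e ≤ 10 := by
    calc (10 : ℝ) ^ e ≤ 10 ^ (1 : ℝ) := Real.rpow_le_rpow_of_exponent_le (by norm_num) he1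
      _ = 10 := Real.rpow_one _
  have hLe : Lν * Lν ^ e = Lν ^ (2 / (1 + ν)) := by
    rw [← Real.rpow_one_add' hL (by positivity)]
    congr 1
    rw [he]; field_simp; norm_num
  calc holderSmoothness Lν ν (ε / (20 * K ^ p)) ≤ Lν * (10 * (Lν * K ^ p / ε)) ^ e := by
        unfold holderSmoothness
        gcongr
    _ = 10 ^ e * (μ * X * (K ^ p) ^ e) := by
        rw [Real.mul_rpow (by norm_num) (by positivity),
          Real.div_rpow (by positivity) hε.le, Real.mul_rpow hL (by positivity), hX, ← hLe]
        field_simp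
    _ ≤ 10 * (μ * K ^ ((1 + 2 * p * ν + ν) / (1 + ν)) * (K ^ p) ^ e) := by gcongr
    _ = 10 * μ * K * K ^ p := by
        have h3 : K ^ ((1 + 2 * p * ν + ν) / (1 + ν)) * (K ^ p) ^ e = K * K ^ p := by
          rw [← Real.rpow_mul hK0.le, ← Real.rpow_add hK0, ← Real.rpow_one_add' hK0.le
            (by positivity)]
          congr 1
          rw [he]; field_simp; ring
        rw [mul_assoc μ, h3]
        ring

end Rate

/-! ### Choice of the parameters and complexity of the stages -/

section Stages

/-- The accuracy to be reached before stage `j`: it is divided by `4` in each stage, and equals `ε`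
after `T` stages. -/
noncomputable def stageAccuracy (ε : ℝ) (T j : ℕ) : ℝ := ε * 4 ^ T / 4 ^ j

theorem stageAccuracy_pos {ε : ℝ} (hε : 0 < ε) (T j : ℕ) : 0 < stageAccuracy ε T j := by
  unfold stageAccuracy
  positivity

theorem stageAccuracy_self (ε : ℝ) (T : ℕ) : stageAccuracy ε T T = ε := by
  unfold stageAccuracy
  field_simp

theorem stageAccuracy_eq_four_mul (ε : ℝ) (T j : ℕ) :
    stageAccuracy ε T j = 4 * stageAccuracy ε T (j + 1) := by
  unfold stageAccuracy
  rw [pow_succ]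
  field_simp

theorem le_stageAccuracy {ε : ℝ} (hε : 0 < ε) {T j : ℕ} (hj : j ≤ T) :
    ε ≤ stageAccuracy ε T j := by
  unfold stageAccuracy
  rw [le_div_iff₀ (by positivity)]
  gcongr
  norm_num

/-- The parameters of the restarted method with `T` stages for the iteration rate `K` and the
smoothness constant `Λ`. The three summands of `β` account for the smoothness of the objective, the
variance of the gradients and the requirement that `β` is positive. With the constants in `n`, each
of the three error terms of a stage is at most a quarter of the accuracy to be reached. -/
noncomputable def stagedParams {H : Type*} (Z : ℝ → H → H → H) (u₀ : H) (K p Λ μ D ε : ℝ)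
    (T : ℕ) : RestartParams H where
  Z := Z
  M := K ^ p
  β j := 12 * (Λ / K ^ p) + 4 * D / stageAccuracy ε T (j + 1) + μ
  n j := ⌈16000 * K + 512 * (D / (μ * stageAccuracy ε T (j + 1)))⌉₊
  u₀ := u₀

/-- The lengths of the stages grow geometrically as far as they are due to the variance, so this
part of the total is dominated by the last stage. -/
theorem stageStart_stagedParams_le {H : Type*} (Z : ℝ → H → H → H) (u₀ : H)
    {K p Λ μ D ε : ℝ}
    (hK : 1 ≤ K) (hμ : 0 < μ) (hD : 0 ≤ D) (hε : 0 < ε) (T : ℕ) :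
    (stageStart (stagedParams Z u₀ K p Λ μ D ε T).n T : ℝ) ≤
      max (40000 * (K * T)) (40000 * (D / (μ * ε))) := by
  have hgeom : ∀ m : ℕ, ∑ j ∈ Finset.range m, (4 : ℝ) ^ (j + 1) ≤ 4 / 3 * 4 ^ m := by
    intro m
    induction m with
    | zero => norm_num
    | succ m ih =>
      rw [Finset.sum_range_succ, pow_succ]
      linarith
  have hq : 0 ≤ D / (μ * ε) := by positivity
  have hterm : ∀ j, ((stagedParams Z u₀ K p Λ μ D ε T).n j : ℝ) ≤
      16001 * K + 512 * (D / (μ * ε)) / 4 ^ T * 4 ^ (j + 1) := by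
    intro j
    have he := stageAccuracy_pos hε T (j + 1)
    have h1 : 0 ≤ 16000 * K + 512 * (D / (μ * stageAccuracy ε T (j + 1))) := by positivity
    have h2 := (Nat.ceil_lt_add_one h1).le
    have h3 : D / (μ * stageAccuracy ε T (j + 1)) = D / (μ * ε) / 4 ^ T * 4 ^ (j + 1) := by
      unfold stageAccuracy
      field_simp
    simp only [stagedParams]
    rw [h3] at h2 ⊢
    calc _ ≤ _ := h2
      _ ≤ _ := by
        have : 512 * (D / (μ * ε) / 4 ^ T * 4 ^ (j + 1)) =
          512 * (D / (μ * ε)) / 4 ^ T * 4 ^ (j + 1) := by ring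
        linarith
  have hsum : (stageStart (stagedParams Z u₀ K p Λ μ D ε T).n T : ℝ) ≤
      16001 * (K * T) + 683 * (D / (μ * ε)) := by
    rw [stageStart]
    push_cast
    calc _ ≤ ∑ j ∈ Finset.range T, (16001 * K + 512 * (D / (μ * ε)) / 4 ^ T * 4 ^ (j + 1)) :=
          Finset.sum_le_sum fun j _ => hterm j
      _ = 16001 * (K * T) + 512 * (D / (μ * ε)) / 4 ^ T *
          ∑ j ∈ Finset.range T, (4 : ℝ) ^ (j + 1) := by
          rw [Finset.sum_add_distrib, Finset.sum_const, Finset.card_range, nsmul_eq_mul,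
            Finset.mul_sum]
          ring
      _ ≤ 16001 * (K * T) + 512 * (D / (μ * ε)) / 4 ^ T * (4 / 3 * 4 ^ T) := by
          gcongr
          exact hgeom T
      _ = 16001 * (K * T) + 2048 / 3 * (D / (μ * ε)) := by
          field_simp
          ring
      _ ≤ _ := by linarith
  have hKT : 0 ≤ K * T := by positivity
  rcases le_total (K * T) (D / (μ * ε)) with h | h
  · exact le_max_of_le_right (by linarith)
  · exact le_max_of_le_left (by linarith)

variable {H : Type*} [NormedAddCommGroup H] [InnerProductSpace ℝ H]

theorem stagedParams_valid {N : Seminorm ℝ H} {Q : Set H} {V : H → H → ℝ} {Z : ℝ → H → H → H}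
    {u₀ : H} {K p Λ μ D ε : ℝ} (hQ : Convex ℝ Q) (hZ : IsProxMap N Q V Z) (hu₀ : u₀ ∈ Q)
    (hK : 1 ≤ K) (hp : 0 ≤ p) (hΛ : 0 ≤ Λ) (hμ : 0 < μ) (hD : 0 ≤ D) (hε : 0 < ε) (T : ℕ) :
    (stagedParams Z u₀ K p Λ μ D ε T).Valid N Q V where
  convex := hQ
  prox := hZ
  one_le := Real.one_le_rpow hK hp
  β_pos j := by
    have := stageAccuracy_pos hε T (j + 1)
    simp only [stagedParams]
    positivity
  n_pos j := by
    have := stageAccuracy_pos hε T (j + 1)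
    simp only [stagedParams]
    rw [Nat.ceil_pos]
    positivity
  mem := hu₀

/-- The three error terms of a stage, for the parameters chosen in `stagedParams`. -/
theorem stage_error_le {K w μ D ε a n : ℝ} (hK : 1 ≤ K) (hw : 0 ≤ w) (hwK : w ≤ 10 * μ * K)
    (hμ : 0 < μ) (hD : 0 ≤ D) (hε : 0 < ε) (ha : ε ≤ a) (hn : 16000 * K + 512 * (D / (μ * a)) ≤ n) :
    4 * (12 * w + 4 * D / a + μ) * (4 * a / μ) / n + ε / 4 + D / (12 * w + 4 * D / a + μ) ≤ a := by
  have ha0 : 0 < a := hε.trans_le ha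
  have hq : 0 ≤ D / (μ * a) := by positivity
  have hn0 : 0 < n := by linarith
  set β := 12 * w + 4 * D / a + μ with hβ
  have hβ0 : 0 < β := by positivity
  have h1 : D / β ≤ a / 4 := by
    rw [div_le_iff₀ hβ0]
    have : a / 4 * β = a / 4 * (12 * w) + D + a / 4 * μ := by rw [hβ]; field_simp
    rw [this]
    have : 0 ≤ a / 4 * (12 * w) + a / 4 * μ := by positivity
    linarith
  have h2 : β ≤ μ * (n / 128) := by
    have h3 : β ≤ μ * (121 * K + 4 * (D / (μ * a))) := by
      have h4 : μ * (121 * K + 4 * (D / (μ * a))) = 121 * μ * K + 4 * D / a := by field_simp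
      rw [h4, hβ]
      nlinarith
    refine h3.trans (mul_le_mul_of_nonneg_left ?_ hμ.le)
    linarith
  have h5 : 4 * β * (4 * a / μ) / n ≤ a / 8 := by
    calc 4 * β * (4 * a / μ) / n ≤ 4 * (μ * (n / 128)) * (4 * a / μ) / n := by gcongr
      _ = a / 8 := by field_simp; norm_num
  linarith

variable [MeasurableSpace H] {Ξ : Type*} [MeasurableSpace Ξ] {P : Measure Ξ}
  {N : Seminorm ℝ H} {κ : ℝ} {Q : Set H} {φ F : H → Ξ → ℝ} {G : H → Ξ → H} {μ μ' δ L D : ℝ}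

theorem IsOracle.isInexactModel (hμ : 0 ≤ μ) (hO : IsOracle N Q P φ F G μ δ L D) :
    IsInexactModel N Q (objective P φ) (fun x => ∫ ξ, F x ξ ∂P) (meanGrad P G) δ L where
  lower x hx y hy := by
    have h1 := hO.lower x hx y hy
    have h2 : 0 ≤ μ / 2 * N (y - x) ^ 2 := by positivity
    simp only [meanGrad]
    linarith
  upper x hx y hy := by
    have h1 := hO.upper x hx y hy
    simp only [meanGrad]
    linarith

variable [BorelSpace H] [IsProbabilityMeasure P] {V : H → H → ℝ}

theorem RestartParams.Valid.integrable_comp_centre {A : RestartParams H} (hA : A.Valid N Q V)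
    (hO : IsOracle N Q P φ F G μ δ L D) {f : H → ℝ} (hf : LowerSemicontinuousOn f Q) {B : ℝ}
    (hB : ∀ x ∈ Q, |f x| ≤ B) (j : ℕ) :
    Integrable (fun ω => f (hA.centre F G j ω)) (Measure.infinitePi fun _ : ℕ => P) := by
  have h1 := measurable_comp_of_lowerSemicontinuousOn hf
    (hA.stronglyMeasurable_centre hO j).measurable (hA.centre_mem j)
  exact (integrable_const B).mono' h1.aestronglyMeasurable
    (Filter.Eventually.of_forall fun ω => hB _ (hA.centre_mem j ω))

/-- Each stage of the restarted method divides the accuracy by `4`. Here `μ` is the modulus that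
relates the accuracy to the prox-distance. -/
theorem IsOracle.integral_centre_succ_sub_le [CompleteSpace H] (hN : ∀ x, ‖x‖ ≤ κ * N x)
    {p ν Lν ε b : ℝ} (hb : ∀ x ∈ Q, ∀ y ∈ Q, N (x - y) ≤ b) (hp : 0 ≤ p) (hp1 : p ≤ 1)
    (hν : 0 ≤ ν) (hν1 : ν ≤ 1) (hL : 0 ≤ Lν) (hμ : 0 < μ) (hD : 0 ≤ D) (hε : 0 < ε)
    (hδ : 0 < δ) (hδε : δ ≤ ε / (20 * iterationRate p ν Lν μ ε ^ p)) (hμ' : 0 ≤ μ')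
    (hH : HasHolderGradient N Q (objective P φ) Lν ν)
    (hO : IsOracle N Q P φ F G μ' δ (holderSmoothness Lν ν δ) D)
    {Z : ℝ → H → H → H} {u₀ : H} {T : ℕ}
    (hA : (stagedParams Z u₀ (iterationRate p ν Lν μ ε) p
      (holderSmoothness Lν ν (ε / (20 * iterationRate p ν Lν μ ε ^ p))) μ D ε T).Valid N Q V)
    {j : ℕ} (hj : j < T) {x : H} (hx : x ∈ Q)
    (hVint : Integrable (fun ω => V (hA.centre F G j ω) x) (Measure.infinitePi fun _ : ℕ => P))
    (hV : ∫ ω, V (hA.centre F G j ω) x ∂(Measure.infinitePi fun _ : ℕ => P) ≤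
      stageAccuracy ε T j / μ) :
    (∫ ω, objective P φ (hA.centre F G (j + 1) ω) ∂(Measure.infinitePi fun _ : ℕ => P)) -
      objective P φ x ≤ stageAccuracy ε T (j + 1) := by
  have hK := one_le_iterationRate p ν Lν μ ε
  have hΛ := holderSmoothness_le_iterationRate hp hν hν1 hL hμ hε
  set K := iterationRate p ν Lν μ ε
  have hK0 : 0 < K := by linarith
  have hKp : 0 < K ^ p := by positivity
  have hKp1 : K ^ p ≤ K := by
    calc K ^ p ≤ K ^ (1 : ℝ) := Real.rpow_le_rpow_of_exponent_le hK hp1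
      _ = K := Real.rpow_one K
  have hδ' : 0 < ε / (20 * K ^ p) := by positivity
  have hΛ0 := holderSmoothness_nonneg (Lν := Lν) hL hν hν1 hδ'.le
  have hm0 := hO.isInexactModel hμ'
  have hm := hm0.of_le_accuracy hN hA.convex hL hν hν1 hδ hδε hH
  obtain ⟨B, hB⟩ := hm0.exists_abs_le hN (holderSmoothness_nonneg hL hν hν1 hδ.le) hb
  have hfint := hA.integrable_comp_centre hO hH.lowerSemicontinuousOn hB (j + 1)
  set Λ := holderSmoothness Lν ν (ε / (20 * K ^ p))
  have ha := stageAccuracy_pos hε T (j + 1)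
  have hn := Nat.le_ceil (16000 * K + 512 * (D / (μ * stageAccuracy ε T (j + 1))))
  have hq : 0 ≤ D / (μ * stageAccuracy ε T (j + 1)) := by positivity
  have hLβ : 6 * Λ / K ^ p ≤ (12 * (Λ / K ^ p) + 4 * D / stageAccuracy ε T (j + 1) + μ) / 2 := by
    have h1 : 0 ≤ 4 * D / stageAccuracy ε T (j + 1) := by positivity
    have h2 : 6 * Λ / K ^ p = 6 * (Λ / K ^ p) := by ring
    linarith
  have key := hA.integral_centre_succ_le hN hO hD hb (hH.convexOn hA.convex) hm
    (by positivity) hLβ (by simp only [stagedParams]; linarith) hfint hx hVint hV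
  refine key.trans ?_
  simp only [stagedParams]
  have hMδ : K ^ p * (5 * (ε / (20 * K ^ p))) = ε / 4 := by field_simp; norm_num
  rw [hMδ, stageAccuracy_eq_four_mul ε T j]
  refine stage_error_le hK (by positivity) ?_ hμ hD hε (le_stageAccuracy hε hj) hn
  rwa [div_le_iff₀ hKp]

end Stages

/-! ### Existence of the minimizer and the complexity bounds -/

section Final

/-- The admissible oracle error in the theorem is at most the accuracy with which the method
treats the objective as smooth. -/
theorem accuracy_le_of_le {p K S ε : ℝ} (hp : 0 ≤ p) (hK : 1 ≤ K) (hε : 0 < ε) (hKS : K ≤ S) :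
    1 / 20 * (ε / (40000 * S) ^ p) ≤ ε / (20 * K ^ p) := by
  have h1 : K ^ p ≤ (40000 * S) ^ p := by
    apply Real.rpow_le_rpow <;> linarith
  have h2 : 0 < K ^ p := Real.rpow_pos_of_pos (by linarith) p
  calc 1 / 20 * (ε / (40000 * S) ^ p) ≤ 1 / 20 * (ε / K ^ p) := by gcongr
    _ = ε / (20 * K ^ p) := by field_simp

/-- A strongly convex function with Hölder gradient attains its minimum on a bounded closed convex
set, and it grows quadratically away from the minimizer. -/
theorem exists_isMin_quadratic_growth {H : Type*} [NormedAddCommGroup H] [InnerProductSpace ℝ H]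
    [CompleteSpace H] {Q : Set H} {f : H → ℝ} {μ B : ℝ} (hcl : IsClosed Q) (hne : Q.Nonempty)
    (hμ : 0 < μ) (hf : StrongConvexOn Q μ f) (hlsc : LowerSemicontinuousOn f Q)
    (hB : ∀ x ∈ Q, |f x| ≤ B) :
    ∃ z ∈ Q, ∀ x ∈ Q, f z + μ / 2 * ‖x - z‖ ^ 2 ≤ f x := by
  have hB0 : 0 ≤ B := by
    obtain ⟨q, hq⟩ := hne
    exact (abs_nonneg _).trans (hB q hq)
  have hd : IsProxStructure (normSeminorm ℝ H) Q (fun x => f x / μ) √(4 * B / μ) := by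
    refine ⟨fun x hx c hc => ?_, fun x hx y hy a b ha hb hab => ?_, fun x hx y hy => ?_⟩
    · have h := hlsc x hx (c * μ) ((lt_div_iff₀ hμ).1 hc)
      filter_upwards [h] with t ht using (lt_div_iff₀ hμ).2 ht
    · have h := hf.2 hx hy ha hb hab
      simp only [smul_eq_mul] at h
      simp only [coe_normSeminorm]
      rw [div_le_iff₀ hμ]
      calc _ ≤ _ := h
        _ = _ := by field_simp
    · rw [Real.sq_sqrt (by positivity), ← sub_div, div_div, mul_comm μ 2, ← div_div]
      gcongr
      linarith [(abs_le.1 (hB x hx)).2, (abs_le.1 (hB y hy)).1]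
  obtain ⟨z, hz, h⟩ := hd.exists_argmin (κ := 1) (by simp) (Real.sqrt_nonneg _) hne hcl hf.1 hμ 0
  refine ⟨z, hz, fun x hx => ?_⟩
  have h1 := h x hx
  simpa [mul_div_cancel₀ _ hμ.ne'] using h1

end Final

theorem mainTheorem3 :
    ∃ C c : ℝ, 0 < C ∧ 0 < c ∧
      -- convex case, an arbitrary norm `N` and prox-structure
      (∀ (H : Type*) [NormedAddCommGroup H] [InnerProductSpace ℝ H] [CompleteSpace H]
        [MeasurableSpace H] [BorelSpace H]
        (N : Seminorm ℝ H) (κ : ℝ) (_ : ∀ x, ‖x‖ ≤ κ * N x)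
        (Q : Set H) (_ : Q.Nonempty) (_ : IsClosed Q) (_ : Convex ℝ Q)
        (d : H → ℝ) (R : ℝ) (_ : 0 < R) (_ : IsProxStructure N Q d R)
        (p ν Lν D ε : ℝ) (_ : 0 ≤ p) (_ : p ≤ 1) (_ : 0 ≤ ν) (_ : ν ≤ 1)
        (_ : 0 ≤ Lν) (_ : 0 ≤ D) (_ : 0 < ε),
        ∃ (n : ℕ) (A : OracleMethod Q),
          (n : ℝ) ≤ max (C * convexRate p ν Lν R ε) (C * (D * R ^ 2 / ε ^ 2)) ∧
          ∀ (Ξ : Type*) [MeasurableSpace Ξ] (P : Measure Ξ) [IsProbabilityMeasure P]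
            (φ F : H → Ξ → ℝ) (G : H → Ξ → H) (δ : ℝ),
            0 < δ → δ ≤ c * (ε / (C * convexRate p ν Lν R ε) ^ p) →
            HasHolderGradient N Q (objective P φ) Lν ν →
            IsOracle N Q P φ F G 0 δ (holderSmoothness Lν ν δ) D →
            A.Solves P φ F G n ε) ∧
      -- strongly convex case, the Euclidean norm and prox-structure centred at `x₀`
      (∀ (H : Type*) [NormedAddCommGroup H] [InnerProductSpace ℝ H] [CompleteSpace H]
        [MeasurableSpace H] [BorelSpace H]
        (Q : Set H) (_ : IsClosed Q) (_ : Convex ℝ Q)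
        (x₀ : H) (_ : x₀ ∈ Q) (R : ℝ) (_ : 0 < R) (_ : ∀ x ∈ Q, ‖x - x₀‖ ≤ R)
        (p ν Lν μ D ε : ℝ) (_ : 0 ≤ p) (_ : p ≤ 1) (_ : 0 ≤ ν) (_ : ν ≤ 1)
        (_ : 0 ≤ Lν) (_ : 0 < μ) (_ : 0 ≤ D) (_ : 0 < ε),
        ∃ (n : ℕ) (A : OracleMethod Q),
          (n : ℝ) ≤ max (C * stronglyConvexRate p ν Lν μ R ε) (C * (D / (μ * ε))) ∧
          ∀ (Ξ : Type*) [MeasurableSpace Ξ] (P : Measure Ξ) [IsProbabilityMeasure P]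
            (φ F : H → Ξ → ℝ) (G : H → Ξ → H) (δ : ℝ),
            0 < δ → δ ≤ c * (ε / (C * stronglyConvexRate p ν Lν μ R ε) ^ p) →
            StrongConvexOn Q μ (objective P φ) →
            HasHolderGradient (normSeminorm ℝ H) Q (objective P φ) Lν ν →
            IsOracle (normSeminorm ℝ H) Q P φ F G μ δ (holderSmoothness Lν ν δ) D →
            A.Solves P φ F G n ε) := by
  refine ⟨40000, 1 / 20, by norm_num, by norm_num, ?_, ?_⟩
  · intro H _ _ _ _ _ N κ hN Q hne hcl hQ d R hR hd p ν Lν D ε hp hp1 hν hν1 hL hD hε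
    obtain ⟨v, Z, hZ, hv⟩ := hd.exists_isProxMap hN hR.le hne hcl hQ
    obtain ⟨u₀, hu₀⟩ := hne
    have hμ : 0 < ε / R ^ 2 := by positivity
    have hK := one_le_iterationRate p ν Lν (ε / R ^ 2) ε
    have hKp : 0 < iterationRate p ν Lν (ε / R ^ 2) ε ^ p :=
      Real.rpow_pos_of_pos (by linarith) p
    have hA := stagedParams_valid hQ hZ hu₀ hK hp
      (holderSmoothness_nonneg (δ := ε / (20 * iterationRate p ν Lν (ε / R ^ 2) ε ^ p)) hL hν hν1
        (by positivity)) hμ hD hε 1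
    refine ⟨stageStart (stagedParams Z u₀ (iterationRate p ν Lν (ε / R ^ 2) ε) p
      (holderSmoothness Lν ν (ε / (20 * iterationRate p ν Lν (ε / R ^ 2) ε ^ p)))
      (ε / R ^ 2) D ε 1).n 1, hA.method, ?_, ?_⟩
    · have h1 : D * R ^ 2 / ε ^ 2 = D / (ε / R ^ 2 * ε) := by field_simp
      rw [convexRate_eq_iterationRate hν hL hR hε, h1]
      simpa using stageStart_stagedParams_le Z u₀ hK hμ hD hε 1
    · intro Ξ _ P _ φ F G δ hδ hδε hH hO
      have hKS : iterationRate p ν Lν (ε / R ^ 2) ε ≤ convexRate p ν Lν R ε :=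
        (convexRate_eq_iterationRate hν hL hR hε).ge
      have hb : ∀ x ∈ Q, ∀ y ∈ Q, N (x - y) ≤ 2 * R := fun x hx y hy =>
        hd.seminorm_sub_le hR.le hQ hx hy
      obtain ⟨B, hB⟩ := (hO.isInexactModel le_rfl).exists_abs_le hN
        (holderSmoothness_nonneg hL hν hν1 hδ.le) hb
      refine ⟨hA.integrable_comp_centre hO hH.lowerSemicontinuousOn hB 1, fun y hy => ?_⟩
      have h := hO.integral_centre_succ_sub_le hN hb hp hp1 hν hν1 hL hμ hD hε hδ
        (hδε.trans (accuracy_le_of_le hp hK hε hKS)) le_rfl hH hA one_pos hy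
        (integrable_const _) (by
          have h2 : stageAccuracy ε 1 0 / (ε / R ^ 2) = 4 * R ^ 2 := by
            unfold stageAccuracy
            field_simp
          rw [h2, integral_const, probReal_univ, one_smul]
          linarith [hv y hy, sq_nonneg R])
      rwa [stageAccuracy_self] at h
  · intro H _ _ _ _ _ Q hcl hQ x₀ hx₀ R hR hQR p ν Lν μ D ε hp hp1 hν hν1 hL hμ hD hε
    obtain ⟨Z, hZ⟩ := exists_isProxMap_euclidean hcl hQ hx₀ hR.le hQR
    have hN : ∀ x : H, ‖x‖ ≤ 1 * normSeminorm ℝ H x := by simp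
    have hK := one_le_iterationRate p ν Lν μ ε
    have hKp : 0 < iterationRate p ν Lν μ ε ^ p := Real.rpow_pos_of_pos (by linarith) p
    obtain ⟨T, hT⟩ : ∃ T : ℕ, (T : ℝ) = max 1 (⌈Real.log (μ * R ^ 2 / ε)⌉ : ℝ) := by
      refine ⟨(max 1 ⌈Real.log (μ * R ^ 2 / ε)⌉).toNat, ?_⟩
      rw [← Int.cast_natCast, Int.toNat_of_nonneg (le_max_of_le_left zero_le_one), Int.cast_max,
        Int.cast_one]
    have hT1 : 1 ≤ T := by
      have : (1 : ℝ) ≤ T := hT ▸ le_max_left _ _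
      exact_mod_cast this
    have hTR : μ * R ^ 2 ≤ ε * 4 ^ T := by
      have h1 : Real.log (μ * R ^ 2 / ε) ≤ T := (Int.le_ceil _).trans (hT ▸ le_max_right _ _)
      have h2 := (Real.log_le_iff_le_exp (by positivity)).1 h1
      have h3 : Real.exp T ≤ 4 ^ T := by
        rw [← Real.exp_one_pow]
        gcongr
        linarith [Real.exp_one_lt_d9]
      rw [← div_le_iff₀' hε]
      exact h2.trans h3
    have hA := stagedParams_valid hQ hZ hx₀ hK hp
      (holderSmoothness_nonneg (δ := ε / (20 * iterationRate p ν Lν μ ε ^ p)) hL hν hν1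
        (by positivity)) hμ hD hε T
    have hrate : stronglyConvexRate p ν Lν μ R ε = iterationRate p ν Lν μ ε * T := by
      rw [hT]
      rfl
    refine ⟨stageStart (stagedParams Z x₀ (iterationRate p ν Lν μ ε) p
      (holderSmoothness Lν ν (ε / (20 * iterationRate p ν Lν μ ε ^ p))) μ D ε T).n T,
      hA.method, ?_, ?_⟩
    · rw [hrate]
      exact stageStart_stagedParams_le Z x₀ hK hμ hD hε T
    · intro Ξ _ P _ φ F G δ hδ hδε hsc hH hO
      have hKS : iterationRate p ν Lν μ ε ≤ stronglyConvexRate p ν Lν μ R ε := by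
        rw [hrate]
        exact le_mul_of_one_le_right (by linarith) (by exact_mod_cast hT1)
      have hb : ∀ x ∈ Q, ∀ y ∈ Q, normSeminorm ℝ H (x - y) ≤ 2 * R := fun x hx y hy => by
        have h1 := norm_sub_le_norm_sub_add_norm_sub x x₀ y
        rw [norm_sub_rev x₀ y] at h1
        simp only [coe_normSeminorm]
        linarith [hQR x hx, hQR y hy]
      obtain ⟨B, hB⟩ := (hO.isInexactModel hμ.le).exists_abs_le hN
        (holderSmoothness_nonneg hL hν hν1 hδ.le) hb
      obtain ⟨z, hz, hmin⟩ := exists_isMin_quadratic_growth hcl ⟨x₀, hx₀⟩ hμ hsc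
        hH.lowerSemicontinuousOn hB
      have hfint := hA.integrable_comp_centre hO hH.lowerSemicontinuousOn hB
      have hVint : ∀ j, Integrable (fun ω => ‖z - hA.centre F G j ω‖ ^ 2 / 2)
          (Measure.infinitePi fun _ : ℕ => P) := fun j => by
        refine (integrable_const ((2 * R) ^ 2 / 2)).mono'
          ((by fun_prop : Continuous fun u : H => ‖z - u‖ ^ 2 / 2).comp_stronglyMeasurable
            (hA.stronglyMeasurable_centre hO j)).aestronglyMeasurable
          (Filter.Eventually.of_forall fun ω => ?_)
        rw [Real.norm_of_nonneg (by positivity)]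
        have := hb z hz _ (hA.centre_mem (F := F) (G := G) j ω)
        simp only [coe_normSeminorm] at this
        gcongr
      have hstage : ∀ j < T, ∫ ω, ‖z - hA.centre F G j ω‖ ^ 2 / 2
          ∂(Measure.infinitePi fun _ : ℕ => P) ≤ stageAccuracy ε T j / μ →
          (∫ ω, objective P φ (hA.centre F G (j + 1) ω)
            ∂(Measure.infinitePi fun _ : ℕ => P)) - objective P φ z ≤
            stageAccuracy ε T (j + 1) := fun j hj hV =>
        hO.integral_centre_succ_sub_le hN hb hp hp1 hν hν1 hL hμ hD hε hδ
          (hδε.trans (accuracy_le_of_le hp hK hε hKS)) hμ.le hH hA hj hz (hVint j) hV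
      -- strong convexity turns the accuracy of a stage into a bound for the distance of its
      -- result, the next prox-centre, from the minimizer
      have hdist : ∀ j < T, ∫ ω, ‖z - hA.centre F G j ω‖ ^ 2 / 2
          ∂(Measure.infinitePi fun _ : ℕ => P) ≤ stageAccuracy ε T j / μ := by
        intro j
        induction j with
        | zero =>
          intro _
          simp only [hA.centre_zero]
          rw [integral_const, probReal_univ, one_smul, le_div_iff₀ hμ]
          have h1 : ‖z - x₀‖ ^ 2 ≤ R ^ 2 := by
            have := hQR z hz
            gcongr
          have h2 : stageAccuracy ε T 0 = ε * 4 ^ T := by simp [stageAccuracy]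
          change ‖z - x₀‖ ^ 2 / 2 * μ ≤ _
          rw [h2]
          nlinarith [sq_nonneg R]
        | succ j ih =>
          intro hj
          have h1 := hstage j (by omega) (ih (by omega))
          have h2 : ∀ ω, ‖z - hA.centre F G (j + 1) ω‖ ^ 2 / 2 ≤
              (objective P φ (hA.centre F G (j + 1) ω) - objective P φ z) / μ := fun ω => by
            have h3 := hmin _ (hA.centre_mem (F := F) (G := G) (j + 1) ω)
            rw [norm_sub_rev] at h3
            rw [le_div_iff₀ hμ]
            linarith
          have h4 := integral_mono (hVint (j + 1))
            (((hfint (j + 1)).sub (integrable_const _)).div_const μ) h2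
          simp only [Pi.sub_apply] at h4
          rw [integral_div μ, integral_sub (hfint (j + 1)) (integrable_const _), integral_const,
            probReal_univ, one_smul] at h4
          exact h4.trans (by gcongr)
      refine ⟨hfint T, fun y hy => ?_⟩
      obtain ⟨m, rfl⟩ : ∃ m, T = m + 1 := ⟨T - 1, by omega⟩
      have h1 := hstage m (by omega) (hdist m (by omega))
      rw [stageAccuracy_self] at h1
      have h2 : objective P φ z ≤ objective P φ y := by
        have h3 := hmin y hy
        have h4 : 0 ≤ μ / 2 * ‖y - z‖ ^ 2 := by positivity
        linarith
      refine le_trans ?_ h1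
      exact sub_le_sub_left h2 _
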